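/- Let $g(t)=2^{1/4}e^{-\pi t^2}$, and for a function or tempered distribution $y$ on $\mathbb{R}$ and $z=\tau+i\omega\in\mathbb{C}$ let $\mathrm{Spec}_g(y)(z)=\left|\int_{\mathbb{R}} y(t)\,g(t-\tau)\,e^{-2i\pi\omega t}\,dt\right|^2$ (for a distribution, the integral denotes the bilinear pairing). For $k\in\mathbb{N}$ let $H_k$ be the $k$-th orthogonal polynomial with respect to the weight $e^{-2\pi t^2}$ on $\mathbb{R}$, and let $h_k\propto H_k\,g$ be the $k$-th Hermite function, normalized so that $\|h_k\|_{L^2}=1$. Let $\xi$ be a complex white Gaussian noise on $\mathbb{R}$, i.e. a random tempered distribution with $\mathbb{E}\,e^{i\operatorname{Re}\langle\xi,\varphi\rangle}=e^{-\|\varphi\|_{L^2}^2/4}$ for every complex-valued Schwartz function $\varphi$ (so that $\langle\xi,\varphi\rangle$ is circular complex Gaussian with $\mathbb{E}|\langle\xi,\varphi\rangle|^2=\|\varphi\|_{L^2}^2$). For $\gamma>0$, let $N(A)$ be the number of zeros of $\mathrm{Spec}_g(\xi+\sqrt{\gamma}\,h_k)$ in $A\subset\mathbb{C}$, and let $B(0,R)=\{z\in\mathbb{C}:|z|<R\}$.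 Then for every $k$ there is a constant $M_k>0$, depending only on $k$, such that for every $\varepsilon\in(0,1/4)$ and every $$\gamma>2k^{-k}e^{k}k!\left(M_k+\sqrt{\log(4/\varepsilon)}\right)^2$$ one has $$\mathbb{P}\left(N\left(B\left(0,\sqrt{k/\pi}\right)\right)=k\right)\ge 1-\varepsilon .$$ -/

import Mathlib

open MeasureTheory Complex

open scoped SchwartzMap ENNReal

/-- Every polynomial times a complex Gaussian `t ↦ exp (a t² + b t)`, `Re a < 0`, is bounded. -/
lemma exists_bound_polynomial_mul_gaussian {a : ℂ} (ha : a.re < 0) (b : ℂ)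
    (p : Polynomial ℂ) :
    ∃ C : ℝ, ∀ t : ℝ, ‖p.eval (t : ℂ) * cexp (a * (t : ℂ) ^ 2 + b * t)‖ ≤ C := by
  induction p using Polynomial.induction_on' with
  | add p q hp hq =>
    obtain ⟨C, hC⟩ := hp
    obtain ⟨D, hD⟩ := hq
    refine ⟨C + D, fun t => ?_⟩
    rw [Polynomial.eval_add, add_mul]
    exact (norm_add_le _ _).trans (add_le_add (hC t) (hD t))
  | monomial n c =>
    have h := cexp_neg_quadratic_isLittleO_abs_rpow_cocompact ha b (-(n : ℝ))
    have h1 := h.bound one_pos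
    rw [Filter.eventually_iff_exists_mem] at h1
    obtain ⟨v, hv, hb⟩ := h1
    obtain ⟨K, hK, hKv⟩ := Filter.mem_cocompact.1 hv
    have hcont : Continuous (fun t : ℝ =>
        ‖(Polynomial.monomial n c).eval (t : ℂ) * cexp (a * (t : ℂ) ^ 2 + b * t)‖) := by
      simp only [Polynomial.eval_monomial]
      fun_prop
    obtain ⟨C, hC⟩ := (hK.image hcont).bddAbove
    refine ⟨max C (‖c‖), fun t => ?_⟩
    by_cases ht : t ∈ K
    · exact le_max_of_le_left (hC ⟨t, ht, rfl⟩)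
    · refine le_max_of_le_right ?_
      have h2 := hb t (hKv ht)
      rw [one_mul, Real.rpow_neg (abs_nonneg t), Real.rpow_natCast, norm_inv, norm_pow,
        Real.norm_eq_abs, abs_abs] at h2
      rw [Polynomial.eval_monomial, norm_mul, norm_mul, norm_pow, Complex.norm_real,
        Real.norm_eq_abs, mul_assoc]
      refine mul_le_of_le_one_right (norm_nonneg c) ?_
      calc |t| ^ n * ‖cexp (a * (t : ℂ) ^ 2 + b * t)‖ ≤ |t| ^ n * (|t| ^ n)⁻¹ := by gcongr
        _ ≤ 1 := mul_inv_le_one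

lemma iteratedDeriv_gaussian (a b c : ℂ) (n : ℕ) :
    ∃ p : Polynomial ℂ, iteratedDeriv n (fun t : ℝ => c * cexp (a * (t : ℂ) ^ 2 + b * t)) =
      fun t : ℝ => p.eval (t : ℂ) * cexp (a * (t : ℂ) ^ 2 + b * t) := by
  induction n with
  | zero => exact ⟨Polynomial.C c, by simp⟩
  | succ n ih =>
    obtain ⟨p, hp⟩ := ih
    refine ⟨Polynomial.derivative p + p * (Polynomial.C (2 * a) * Polynomial.X
      + Polynomial.C b), ?_⟩
    rw [iteratedDeriv_succ, hp]
    funext t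
    have h1 : HasDerivAt (fun z : ℂ => p.eval z * cexp (a * z ^ 2 + b * z))
        ((Polynomial.derivative p).eval (t : ℂ) * cexp (a * (t : ℂ) ^ 2 + b * t) +
          p.eval (t : ℂ) * (cexp (a * (t : ℂ) ^ 2 + b * t) *
            (a * (2 * (t : ℂ)) + b * 1))) (t : ℂ) := by
      refine (p.hasDerivAt _).mul (HasDerivAt.cexp ?_)
      refine HasDerivAt.add (HasDerivAt.const_mul a ?_) ((hasDerivAt_id _).const_mul b)
      simpa using hasDerivAt_pow 2 (t : ℂ)
    rw [h1.comp_ofReal.deriv]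
    simp only [Polynomial.eval_add, Polynomial.eval_mul, Polynomial.eval_C, Polynomial.eval_X]
    ring

/-- The Gaussian window `g(t) = 2^{1/4} e^{-π t²}`. -/
noncomputable def gaussianWindow (t : ℝ) : ℝ :=
  (2 : ℝ) ^ (1 / 4 : ℝ) * Real.exp (-Real.pi * t ^ 2)

/-- The time-frequency shifted window `t ↦ g(t - τ) e^{-2iπωt}`, where `z = τ + iω`. -/
noncomputable def shiftedWindowFun (z : ℂ) (t : ℝ) : ℂ :=
  (gaussianWindow (t - z.re) : ℂ) * cexp (-2 * I * Real.pi * z.im * t)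

lemma shiftedWindowFun_eq (z : ℂ) : ∃ b c : ℂ,
    shiftedWindowFun z = fun t : ℝ => c * cexp (-Real.pi * (t : ℂ) ^ 2 + b * t) := by
  refine ⟨2 * Real.pi * z.re - 2 * I * Real.pi * z.im,
    (((2 : ℝ) ^ (1 / 4 : ℝ) : ℝ) : ℂ) * cexp (-Real.pi * (z.re : ℂ) ^ 2), ?_⟩
  funext t
  simp only [shiftedWindowFun, gaussianWindow]
  push_cast
  rw [mul_assoc, ← Complex.exp_add, mul_assoc _ (cexp _) (cexp _), ← Complex.exp_add]
  congr 2
  ring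

/-- The time-frequency shifted window, as a Schwartz function. -/
noncomputable def shiftedWindow (z : ℂ) : 𝓢(ℝ, ℂ) where
  toFun := shiftedWindowFun z
  smooth' := by
    obtain ⟨b, c, h⟩ := shiftedWindowFun_eq z
    rw [h]
    have : ContDiff ℝ ((⊤ : ℕ∞) : WithTop ℕ∞) (fun t : ℝ => (t : ℂ)) := ofRealCLM.contDiff
    fun_prop
  decay' := by
    intro k n
    obtain ⟨b, c, h⟩ := shiftedWindowFun_eq z
    obtain ⟨p, hp⟩ := iteratedDeriv_gaussian (-Real.pi) b c n
    obtain ⟨C, hC⟩ := exists_bound_polynomial_mul_gaussian (a := (-Real.pi : ℂ))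
      (by simpa using Real.pi_pos) b (Polynomial.X ^ k * p)
    refine ⟨C, fun t => ?_⟩
    rw [norm_iteratedFDeriv_eq_norm_iteratedDeriv, h, hp]
    refine le_trans (le_of_eq ?_) (hC t)
    simp [mul_assoc]

/-- The short-time Fourier transform with Gaussian window of a tempered distribution `y`,
`z = τ + iω ↦ ⟨y, g(· - τ) e^{-2iπω·}⟩` (bilinear pairing). If `y` is a function, this is
`∫ y(t) g(t - τ) e^{-2iπωt} dt`. -/
noncomputable def stft (y : 𝓢'(ℝ, ℂ)) (z : ℂ) : ℂ :=
  y (shiftedWindow z)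

/-- The spectrogram with Gaussian window of a tempered distribution. -/
noncomputable def spectrogram (y : 𝓢'(ℝ, ℂ)) (z : ℂ) : ℝ :=
  ‖stft y z‖ ^ 2

/-- For an `L²` function, the spectrogram is the squared modulus of the usual integral. -/
lemma spectrogram_coe (x : Lp ℂ 2 (volume : Measure ℝ)) (z : ℂ) :
    spectrogram (x : 𝓢'(ℝ, ℂ)) z =
      ‖∫ t : ℝ, x t * (gaussianWindow (t - z.re) : ℂ) *
        cexp (-2 * I * Real.pi * z.im * t)‖ ^ 2 := by
  unfold spectrogram stft
  rw [Lp.toTemperedDistribution_apply]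
  congr 2
  refine integral_congr_ae (Filter.Eventually.of_forall fun t => ?_)
  change shiftedWindowFun z t * x t = _
  unfold shiftedWindowFun
  ring

/-- The number of zeros in `A` of the spectrogram of `y`. -/
noncomputable def zeroCount (y : 𝓢'(ℝ, ℂ)) (A : Set ℂ) : ℕ∞ :=
  {z ∈ A | spectrogram y z = 0}.encard

/-- `ξ` is a complex white Gaussian noise on `ℝ`: a random tempered distribution with
characteristic functional `E exp(i Re ⟨ξ, φ⟩) = exp(-‖φ‖₂² / 4)`. Equivalently, `⟨ξ, φ⟩` is a
centred circular complex Gaussian family with `E |⟨ξ, φ⟩|² = ‖φ‖₂²`. -/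
structure IsComplexWhiteNoise {Ω : Type*} [MeasurableSpace Ω] (ξ : Ω → 𝓢'(ℝ, ℂ))
    (P : Measure Ω) : Prop where
  measurable : ∀ φ : 𝓢(ℝ, ℂ), Measurable fun ω => ξ ω φ
  characteristic : ∀ φ : 𝓢(ℝ, ℂ),
    ∫ ω, cexp (I * ((ξ ω φ).re : ℂ)) ∂P = cexp (-((∫ t : ℝ, ‖φ t‖ ^ 2 : ℝ) : ℂ) / 4)

/-- `H` is a `k`-th orthogonal polynomial with respect to the weight `t ↦ e^{-2πt²}`. -/
def IsOrthogonalPolynomial (k : ℕ) (H : Polynomial ℝ) : Prop :=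
  H.degree = k ∧ ∀ Q : Polynomial ℝ, Q.degree < k →
    ∫ t : ℝ, H.eval t * Q.eval t * Real.exp (-2 * Real.pi * t ^ 2) = 0

/-- `h` is a `k`-th Hermite function: proportional to `H_k g` and of unit `L²` norm
(this determines `h` up to a factor of modulus one). -/
def IsHermiteFunction (k : ℕ) (h : Lp ℂ 2 (volume : Measure ℝ)) : Prop :=
  ‖h‖ = 1 ∧ ∃ (H : Polynomial ℝ) (c : ℂ), IsOrthogonalPolynomial k H ∧
    h =ᵐ[volume] fun t : ℝ => c * ((H.eval t * gaussianWindow t : ℝ) : ℂ)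

/-! Up to conjugating `z` and a nowhere vanishing factor, the Gaussian STFT of a tempered
distribution is an entire function, its Bargmann transform (`differentiable_bargmann`,
`norm_bargmann`). Counting spectrogram zeros in a centred disc therefore means counting zeros of an
entire function. The transform of `h_k` is the monomial `a w ^ k` with `‖a‖ ^ 2 = π ^ k / k!`
(`IsHermiteFunction.bargmann_eq`), so signal plus noise is a perturbation of `√γ a w ^ k`.

If the transform of the noise stays below `v = √γ ‖a‖ R ^ k` on the circle `‖w‖ = R = √(k/π)`,
Rouché's theorem gives `k` zeros with multiplicity inside. For `k ≥ 1` this radius maximizes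
`e^(-π‖w‖²/2) ‖w‖ ^ k`, which is where `k ^ k e^(-k) / k!` comes from. Two probabilistic facts
finish the proof.

The zeros are almost surely simple (`measure_exists_double_zero`). Near a double zero the function
is quadratically small, hence small at some point of a grid of mesh `1/n`. There are `O(n²)` grid
points, and each is that small with probability `O(n⁻⁴)`.

The maximum of the noise on the circle has a Gaussian tail (`measure_exists_sphere_le`). A mean
value inequality bounds `exp (b ‖F w‖ ^ 2)` by its average over a slightly larger circle, and
Markov's inequality applies to that average, whose expectation is finite because each value of the
STFT of the noise is a standard circular Gaussian. -/

/-! ### Holomorphic dependence of the translated Gaussian on the translation -/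

lemma norm_le_mul_sq_of_norm_deriv_deriv_le {F : ℂ → ℂ} (hF : Differentiable ℂ F) {w z : ℂ}
    (h0 : F w = 0) (h1 : deriv F w = 0) {C : ℝ}
    (hC : ∀ y ∈ Metric.closedBall w ‖z - w‖, ‖deriv (deriv F) y‖ ≤ C) :
    ‖F z‖ ≤ C * ‖z - w‖ ^ 2 := by
  have hmem : w ∈ Metric.closedBall w ‖z - w‖ := Metric.mem_closedBall_self (norm_nonneg _)
  have hC0 : 0 ≤ C := (norm_nonneg _).trans (hC w hmem)
  have h2 : ∀ y ∈ Metric.closedBall w ‖z - w‖, ‖deriv F y‖ ≤ C * ‖z - w‖ := by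
    intro y hy
    have := (convex_closedBall w ‖z - w‖).norm_image_sub_le_of_norm_deriv_le
      (f := deriv F) (fun x _ => hF.deriv x) hC hmem hy
    rw [h1, sub_zero] at this
    refine this.trans ?_
    rw [mem_closedBall_iff_norm] at hy
    gcongr
  have h3 := (convex_closedBall w ‖z - w‖).norm_image_sub_le_of_norm_deriv_le
      (f := F) (fun x _ => hF x) h2 hmem (mem_closedBall_iff_norm.2 le_rfl)
  rw [h0, sub_zero] at h3
  exact h3.trans (le_of_eq (by ring))

/-- Two Cauchy estimates on circles of radius one carry the bound `B` from `q` on radius 3 to `q'`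
on radius 2 and `q''` on radius 1, with no loss in the constant. -/
lemma norm_taylor_remainder_le {q : ℂ → ℂ} (hq : Differentiable ℂ q) {s h : ℂ} (hh : ‖h‖ ≤ 1)
    {B : ℝ} (hB : ∀ z ∈ Metric.closedBall s 3, ‖q z‖ ≤ B) :
    ‖q (s + h) - q s - h * deriv q s‖ ≤ B * ‖h‖ ^ 2 := by
  have h1 : ∀ z ∈ Metric.closedBall s 2, ‖deriv q z‖ ≤ B := by
    intro z hz
    have := Complex.norm_deriv_le_of_forall_mem_sphere_norm_le one_pos
      (hq.diffContOnCl (s := Metric.ball z 1)) fun y hy => hB y (by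
        rw [Metric.mem_sphere] at hy
        rw [Metric.mem_closedBall] at hz ⊢
        linarith [dist_triangle y z s])
    simpa using this
  have h2 : ∀ z ∈ Metric.closedBall s 1, ‖deriv (deriv q) z‖ ≤ B := by
    intro z hz
    have := Complex.norm_deriv_le_of_forall_mem_sphere_norm_le one_pos
      (hq.deriv.diffContOnCl (s := Metric.ball z 1)) fun y hy => h1 y (by
        rw [Metric.mem_sphere] at hy
        rw [Metric.mem_closedBall] at hz ⊢
        linarith [dist_triangle y z s])
    simpa using this
  have hd : ∀ z, HasDerivAt (fun z => q z - q s - (z - s) * deriv q s)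
      (deriv q z - deriv q s) z := fun z => by
    simpa using ((hq z).hasDerivAt.sub_const (q s)).fun_sub
      (((hasDerivAt_id z).sub_const s).mul_const (deriv q s))
  have hd' : deriv (fun z => q z - q s - (z - s) * deriv q s) = fun z => deriv q z - deriv q s :=
    funext fun z => (hd z).deriv
  have := norm_le_mul_sq_of_norm_deriv_deriv_le (F := fun z => q z - q s - (z - s) * deriv q s)
    (fun z => (hd z).differentiableAt) (w := s) (z := s + h) (by simp) (by simp [hd'])
    (C := B) (fun y hy => by
      rw [hd', deriv_sub_const]
      refine h2 y (Metric.closedBall_subset_closedBall ?_ hy)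
      simpa using hh)
  simpa using this

lemma iteratedDeriv_comp_ofReal_sub {u : ℂ → ℂ} (hu : Differentiable ℂ u) (w : ℂ) (n : ℕ) :
    iteratedDeriv n (fun t : ℝ => u (t - w)) = fun t : ℝ => iteratedDeriv n u (t - w) := by
  induction n with
  | zero => simp
  | succ n ih =>
    rw [iteratedDeriv_succ, ih]
    funext t
    have hd : Differentiable ℂ (iteratedDeriv n u) :=
      (hu.contDiff (n := ⊤)).differentiable_iteratedDeriv n (by simp)
    have h1 : HasDerivAt (fun z : ℂ => iteratedDeriv n u (z - w))
        (deriv (iteratedDeriv n u) (t - w)) (t : ℂ) :=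
      (hd _).hasDerivAt.comp_sub_const _ _
    rw [h1.comp_ofReal.deriv, iteratedDeriv_succ]

/-- The entire extension of the Gaussian window. -/
noncomputable def entireWindow (s : ℂ) : ℂ :=
  (((2 : ℝ) ^ (1 / 4 : ℝ) : ℝ) : ℂ) * cexp (-Real.pi * s ^ 2)

lemma differentiable_entireWindow : Differentiable ℂ entireWindow := by
  unfold entireWindow
  fun_prop

/-- Complex translations of bounded size cost only a bounded factor against the Gaussian decay.
Uniformity in `w` is what makes Cauchy estimates available for Schwartz seminorms. -/
lemma exists_bound_entireWindow (k : ℕ) (ρ : ℝ) :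
    ∃ C : ℝ, ∀ (t : ℝ) (w : ℂ), ‖w‖ ≤ ρ → |t| ^ k * ‖entireWindow (t - w)‖ ≤ C := by
  refine ⟨(2 : ℝ) ^ (1 / 4 : ℝ) * (k.factorial * Real.exp (1 + 2 * Real.pi * ρ ^ 2)),
    fun t w hw => ?_⟩
  have h1 : ‖entireWindow (t - w)‖ = (2 : ℝ) ^ (1 / 4 : ℝ) *
      Real.exp (-Real.pi * ((t - w.re) ^ 2 - w.im ^ 2)) := by
    rw [entireWindow, norm_mul, Complex.norm_real, Complex.norm_exp,
      Real.norm_of_nonneg (by positivity)]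
    congr 2
    simp [sq]
  have hre : w.re ^ 2 + w.im ^ 2 ≤ ρ ^ 2 := by
    have : ‖w‖ ^ 2 ≤ ρ ^ 2 := by gcongr
    rwa [← Complex.normSq_eq_norm_sq, Complex.normSq_apply, ← sq, ← sq] at this
  have h2 : |t| ^ k ≤ k.factorial * Real.exp |t| := by
    have := Real.pow_div_factorial_le_exp |t| (abs_nonneg t) k
    rw [div_le_iff₀ (by positivity)] at this
    linarith
  have hpi := Real.pi_gt_three
  rw [h1]
  calc |t| ^ k * ((2 : ℝ) ^ (1 / 4 : ℝ) * Real.exp (-Real.pi * ((t - w.re) ^ 2 - w.im ^ 2)))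
      ≤ (k.factorial * Real.exp |t|) * ((2 : ℝ) ^ (1 / 4 : ℝ) *
          Real.exp (-Real.pi * (t ^ 2 / 2) + 2 * Real.pi * ρ ^ 2)) := by
        gcongr
        nlinarith [sq_nonneg (t - 2 * w.re), sq_nonneg w.im]
    _ = (2 : ℝ) ^ (1 / 4 : ℝ) * (k.factorial *
          Real.exp (|t| + (-Real.pi * (t ^ 2 / 2) + 2 * Real.pi * ρ ^ 2))) := by
        rw [Real.exp_add |t|]; ring
    _ ≤ _ := by
        refine mul_le_mul_of_nonneg_left (mul_le_mul_of_nonneg_left (Real.exp_le_exp.2 ?_)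
          (by positivity)) (by positivity)
        nlinarith [sq_nonneg (|t| - 1), sq_abs t, sq_nonneg t]

/-- The translate of the Gaussian window by a complex number, as a Schwartz function. -/
noncomputable def translatedWindow (w : ℂ) : 𝓢(ℝ, ℂ) :=
  cexp (Real.pi * (w.re : ℂ) ^ 2 - Real.pi * w ^ 2) • shiftedWindow (starRingEnd ℂ w)

/-- Expanding `-π (t - w) ^ 2` with `w = x + iy`, the part depending on `t` is that of the window
shifted to `x - iy`. This is why a conjugate appears in the definition. -/
lemma translatedWindow_apply (w : ℂ) (t : ℝ) :
    translatedWindow w t = entireWindow (t - w) := by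
  rw [translatedWindow, _root_.smul_apply, smul_eq_mul]
  change _ * shiftedWindowFun _ t = _
  simp only [shiftedWindowFun, gaussianWindow, entireWindow, Complex.conj_re, Complex.conj_im]
  push_cast
  rw [mul_assoc ((2 ^ (1 / 4 : ℝ) : ℝ) : ℂ), ← Complex.exp_add, mul_left_comm, ← Complex.exp_add]
  congr 2
  have hw := (Complex.re_add_im w).symm
  generalize w.re = x at *
  generalize w.im = y at *
  subst hw
  ring

/-- The error of the difference quotient is `u (t - w)` with `u` entire. Cauchy's estimate on a unit
circle replaces the `n`-th derivative of `u` by `u` itself, and the Taylor remainder bound makes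
that `O(‖h‖)`. The weight `|t| ^ k` is a constant for the complex variable, so every Schwartz
seminorm is reached this way. -/
lemma tendsto_slope_translatedWindow (w : ℂ) :
    Filter.Tendsto (fun h : ℂ => h⁻¹ • (translatedWindow (w + h) - translatedWindow w))
      (nhdsWithin 0 {0}ᶜ) (nhds (-SchwartzMap.derivCLM ℂ ℂ (translatedWindow w))) := by
  rw [(schwartz_withSeminorms ℂ ℝ ℂ).tendsto_nhds]
  rintro ⟨k, n⟩ ε hε
  -- The 4 is 1 for the circle in Cauchy's estimate plus 3 for the ball in the Taylor remainder
  -- bound.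
  obtain ⟨C, hC⟩ := exists_bound_entireWindow k (‖w‖ + 4)
  have hC0 : 0 ≤ C := by
    refine le_trans ?_ (hC 0 0 (by rw [norm_zero]; positivity))
    positivity
  have hderiv : ∀ t : ℝ, deriv (translatedWindow w) t = deriv entireWindow (t - w) := by
    intro t
    have h1 : HasDerivAt (fun z : ℂ => entireWindow (z - w))
        (deriv entireWindow (t - w)) (t : ℂ) :=
      (differentiable_entireWindow _).hasDerivAt.comp_sub_const _ _
    rw [show (translatedWindow w : ℝ → ℂ) = fun t : ℝ => entireWindow (t - w) from
      funext (translatedWindow_apply w), h1.comp_ofReal.deriv]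
  have key : ∀ h : ℂ, h ≠ 0 → ‖h‖ ≤ 1 →
      schwartzSeminormFamily ℂ ℝ ℂ (k, n) (h⁻¹ • (translatedWindow (w + h) - translatedWindow w) -
        -SchwartzMap.derivCLM ℂ ℂ (translatedWindow w)) ≤ n.factorial * C * ‖h‖ := by
    intro h hh0 hh
    set u : ℂ → ℂ := fun s => h⁻¹ * (entireWindow (s + -h) - entireWindow s - -h *
      deriv entireWindow s) with hu
    have hud : Differentiable ℂ u := by
      have h1 := differentiable_entireWindow
      have h2 := differentiable_entireWindow.deriv
      fun_prop
    have hfun : ((h⁻¹ • (translatedWindow (w + h) - translatedWindow w) -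
        -SchwartzMap.derivCLM ℂ ℂ (translatedWindow w) : 𝓢(ℝ, ℂ)) : ℝ → ℂ) =
        fun t : ℝ => u (t - w) := by
      funext t
      simp only [_root_.sub_apply, _root_.smul_apply, _root_.neg_apply,
        SchwartzMap.derivCLM_apply, hderiv, translatedWindow_apply, hu, smul_eq_mul]
      rw [show (t : ℂ) - (w + h) = t - w + -h by ring]
      field_simp
    refine SchwartzMap.seminorm_le_bound' ℂ k n _ (by positivity) fun t => ?_
    rw [hfun, iteratedDeriv_comp_ofReal_sub hud]
    have hbound : ∀ z ∈ Metric.sphere ((t : ℂ) - w) 1, ‖((|t| ^ k : ℝ) : ℂ) * u z‖ ≤ C * ‖h‖ := by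
      intro z hz
      have h3 := norm_taylor_remainder_le
        (q := fun z => ((|t| ^ k : ℝ) : ℂ) * entireWindow z) (s := z) (h := -h) (B := C)
        (differentiable_entireWindow.const_mul _) (by simpa using hh) (fun y hy => by
          have h4 := hC t (t - y) (by
            rw [Metric.mem_closedBall, dist_eq_norm] at hy
            rw [Metric.mem_sphere, dist_eq_norm] at hz
            calc ‖(t : ℂ) - y‖ = ‖w - (z - (t - w)) - (y - z)‖ := by ring_nf
              _ ≤ ‖w‖ + ‖z - (t - w)‖ + ‖y - z‖ :=
                (norm_sub_le _ _).trans (by gcongr; exact norm_sub_le _ _)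
              _ ≤ ‖w‖ + 4 := by linarith)
          rw [sub_sub_cancel] at h4
          rw [norm_mul, Complex.norm_real, Real.norm_of_nonneg (by positivity)]
          exact h4)
      rw [deriv_const_mul _ (differentiable_entireWindow _), norm_neg] at h3
      have h5 : ((|t| ^ k : ℝ) : ℂ) * u z = h⁻¹ * (((|t| ^ k : ℝ) : ℂ) * entireWindow (z + -h) -
          ((|t| ^ k : ℝ) : ℂ) * entireWindow z -
          -h * (((|t| ^ k : ℝ) : ℂ) * deriv entireWindow z)) := by
        rw [hu]; ring
      rw [h5, norm_mul, norm_inv]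
      have hhpos : 0 < ‖h‖ := norm_pos_iff.2 hh0
      calc _ ≤ ‖h‖⁻¹ * (C * ‖h‖ ^ 2) := by gcongr
        _ = C * ‖h‖ := by field_simp
    have h6 := Complex.norm_iteratedDeriv_le_of_forall_mem_sphere_norm_le n one_pos
      ((hud.const_mul ((|t| ^ k : ℝ) : ℂ)).diffContOnCl (s := Metric.ball ((t : ℂ) - w) 1)) hbound
    rw [iteratedDeriv_const_mul_field, norm_mul, Complex.norm_real,
      Real.norm_of_nonneg (by positivity)] at h6
    refine h6.trans (le_of_eq ?_)
    simp [mul_assoc]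
  have hsmall : ∀ᶠ h : ℂ in nhdsWithin 0 {0}ᶜ, n.factorial * C * ‖h‖ < ε := by
    refine Filter.Eventually.filter_mono nhdsWithin_le_nhds ?_
    have : Filter.Tendsto (fun h : ℂ => n.factorial * C * ‖h‖) (nhds 0) (nhds 0) := by
      have : Continuous (fun h : ℂ => n.factorial * C * ‖h‖) := by fun_prop
      simpa using this.tendsto 0
    exact this.eventually (gt_mem_nhds hε)
  have hone : ∀ᶠ h : ℂ in nhdsWithin 0 {0}ᶜ, ‖h‖ ≤ 1 :=
    Filter.Eventually.filter_mono nhdsWithin_le_nhds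
      (Filter.mem_of_superset (Metric.closedBall_mem_nhds (0 : ℂ) one_pos)
        fun h hh => by simpa using hh)
  filter_upwards [hsmall, hone, self_mem_nhdsWithin] with h h1 h2 h3
  exact (key h h3 h2).trans_lt h1

lemma differentiable_apply_translatedWindow (y : 𝓢'(ℝ, ℂ)) :
    Differentiable ℂ fun w => y (translatedWindow w) := by
  intro w
  refine HasDerivAt.differentiableAt
    (f' := y (-SchwartzMap.derivCLM ℂ ℂ (translatedWindow w))) ?_
  rw [hasDerivAt_iff_tendsto_slope_zero]
  have := ((map_continuous y).tendsto _).comp (tendsto_slope_translatedWindow w)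
  refine this.congr fun h => ?_
  simp only [Function.comp_apply, map_smul, map_sub]

/-! ### The Bargmann transform and the zeros of the spectrogram -/

/-- The Bargmann transform of a tempered distribution. -/
noncomputable def bargmann (y : 𝓢'(ℝ, ℂ)) (w : ℂ) : ℂ :=
  cexp (Real.pi * w ^ 2 / 2) * y (translatedWindow w)

lemma differentiable_bargmann (y : 𝓢'(ℝ, ℂ)) : Differentiable ℂ (bargmann y) := by
  have h : Differentiable ℂ fun w : ℂ => cexp (Real.pi * w ^ 2 / 2) := by fun_prop
  exact h.mul (differentiable_apply_translatedWindow y)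

lemma bargmann_eq_mul_stft (y : 𝓢'(ℝ, ℂ)) (w : ℂ) :
    bargmann y w =
      cexp (Real.pi * (w.re : ℂ) ^ 2 - Real.pi * w ^ 2 / 2) * stft y (starRingEnd ℂ w) := by
  rw [bargmann, translatedWindow, map_smul, smul_eq_mul, ← mul_assoc, ← Complex.exp_add, stft]
  ring_nf

lemma norm_bargmann (y : 𝓢'(ℝ, ℂ)) (w : ℂ) :
    ‖bargmann y w‖ = Real.exp (Real.pi * ‖w‖ ^ 2 / 2) * ‖stft y (starRingEnd ℂ w)‖ := by
  rw [bargmann_eq_mul_stft, norm_mul, Complex.norm_exp]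
  congr 2
  rw [← Complex.normSq_eq_norm_sq, Complex.normSq_apply]
  simp [sq]
  ring

lemma bargmann_add (y y' : 𝓢'(ℝ, ℂ)) (w : ℂ) :
    bargmann (y + y') w = bargmann y w + bargmann y' w := by
  simp only [bargmann, ← mul_add]
  rfl

lemma bargmann_smul (c : ℂ) (y : 𝓢'(ℝ, ℂ)) (w : ℂ) :
    bargmann (c • y) w = c * bargmann y w := by
  simp only [bargmann]
  rw [mul_left_comm]
  rfl

lemma continuous_spectrogram (y : 𝓢'(ℝ, ℂ)) : Continuous (spectrogram y) := by
  have h : spectrogram y = fun z => (Real.exp (-(Real.pi * ‖z‖ ^ 2 / 2)) *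
      ‖bargmann y (starRingEnd ℂ z)‖) ^ 2 := by
    funext z
    rw [norm_bargmann, RCLike.norm_conj, Complex.conj_conj, ← mul_assoc, ← Real.exp_add,
      neg_add_cancel, Real.exp_zero, one_mul, spectrogram]
  rw [h]
  have := (differentiable_bargmann y).continuous
  fun_prop

lemma spectrogram_conj_eq_zero_iff (y : 𝓢'(ℝ, ℂ)) (w : ℂ) :
    spectrogram y (starRingEnd ℂ w) = 0 ↔ bargmann y w = 0 := by
  rw [← norm_eq_zero (a := bargmann y w), norm_bargmann, mul_eq_zero, spectrogram,
    sq_eq_zero_iff]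
  simp [Real.exp_ne_zero]

lemma zeroCount_ball (y : 𝓢'(ℝ, ℂ)) (R : ℝ) :
    zeroCount y (Metric.ball 0 R) = {w | ‖w‖ < R ∧ bargmann y w = 0}.encard := by
  rw [zeroCount, ← (starRingEnd ℂ).injective.encard_image]
  congr 1
  ext w
  simp only [Set.mem_image, Set.mem_ofPred_eq, mem_ball_zero_iff]
  constructor
  · rintro ⟨z, ⟨hz, h0⟩, rfl⟩
    rw [← spectrogram_conj_eq_zero_iff, Complex.conj_conj, RCLike.norm_conj]
    exact ⟨hz, h0⟩
  · rintro ⟨hw, h0⟩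
    exact ⟨starRingEnd ℂ w, ⟨by rwa [RCLike.norm_conj], (spectrogram_conj_eq_zero_iff y w).2 h0⟩,
      Complex.conj_conj w⟩

/-! ### Gaussian integrals and Hermite polynomials -/

lemma integrable_polynomial_mul_gaussian {a : ℂ} (ha : a.re < 0) (b : ℂ) (p : Polynomial ℂ) :
    Integrable fun t : ℝ => p.eval (t : ℂ) * cexp (a * (t : ℂ) ^ 2 + b * t) := by
  obtain ⟨C, hC⟩ := exists_bound_polynomial_mul_gaussian ha b ((1 + Polynomial.X ^ 2) * p)
  refine (integrable_inv_one_add_sq.const_mul C).mono'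
    (Continuous.aestronglyMeasurable (by fun_prop)) (Filter.Eventually.of_forall fun t => ?_)
  have h := hC t
  have h1 : ‖(1 + (t : ℂ) ^ 2)‖ = 1 + t ^ 2 := by
    rw [← Complex.ofReal_pow, ← Complex.ofReal_one, ← Complex.ofReal_add, Complex.norm_real,
      Real.norm_of_nonneg (by positivity)]
  rw [Polynomial.eval_mul, mul_assoc, norm_mul] at h
  simp only [Polynomial.eval_add, Polynomial.eval_one, Polynomial.eval_pow, Polynomial.eval_X,
    h1] at h
  rw [← div_eq_mul_inv, le_div_iff₀ (by positivity), mul_comm]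
  exact h

/-- The integral of a polynomial against the Gaussian `t ↦ exp (-2πt² + bt)`. -/
noncomputable def gaussianIntegral (b : ℂ) (p : Polynomial ℂ) : ℂ :=
  ∫ t : ℝ, p.eval (t : ℂ) * cexp (-2 * Real.pi * (t : ℂ) ^ 2 + b * t)

lemma neg_two_pi_re : (-2 * Real.pi : ℂ).re < 0 := by
  simpa using Real.pi_pos

lemma gaussianIntegral_sub (b : ℂ) (p q : Polynomial ℂ) :
    gaussianIntegral b (p - q) = gaussianIntegral b p - gaussianIntegral b q := by
  simp only [gaussianIntegral, Polynomial.eval_sub, sub_mul]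
  exact integral_sub (integrable_polynomial_mul_gaussian neg_two_pi_re b p)
    (integrable_polynomial_mul_gaussian neg_two_pi_re b q)

lemma gaussianIntegral_add (b : ℂ) (p q : Polynomial ℂ) :
    gaussianIntegral b (p + q) = gaussianIntegral b p + gaussianIntegral b q := by
  simp only [gaussianIntegral, Polynomial.eval_add, add_mul]
  exact integral_add (integrable_polynomial_mul_gaussian neg_two_pi_re b p)
    (integrable_polynomial_mul_gaussian neg_two_pi_re b q)

lemma gaussianIntegral_C_mul (b c : ℂ) (p : Polynomial ℂ) :
    gaussianIntegral b (Polynomial.C c * p) = c * gaussianIntegral b p := by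
  simp only [gaussianIntegral, Polynomial.eval_mul, Polynomial.eval_C, mul_assoc]
  exact integral_const_mul _ _

/-- Integration by parts: the integral of the derivative of the whole integrand vanishes. -/
lemma gaussianIntegral_derivative (b : ℂ) (p : Polynomial ℂ) :
    gaussianIntegral b (Polynomial.derivative p) =
      4 * Real.pi * gaussianIntegral b (Polynomial.X * p) - b * gaussianIntegral b p := by
  have h := integral_eq_zero_of_hasDerivAt_of_integrable
    (f := fun t : ℝ => p.eval (t : ℂ) * cexp (-2 * Real.pi * (t : ℂ) ^ 2 + b * t))
    (f' := fun t : ℝ => (Polynomial.derivative p - (Polynomial.C (4 * Real.pi : ℂ) *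
      (Polynomial.X * p) - Polynomial.C b * p)).eval (t : ℂ) *
        cexp (-2 * Real.pi * (t : ℂ) ^ 2 + b * t)) (fun t => by
      have h1 : HasDerivAt (fun z : ℂ => p.eval z * cexp (-2 * Real.pi * z ^ 2 + b * z))
          ((Polynomial.derivative p).eval (t : ℂ) * cexp (-2 * Real.pi * (t : ℂ) ^ 2 + b * t) +
            p.eval (t : ℂ) * (cexp (-2 * Real.pi * (t : ℂ) ^ 2 + b * t) *
              (-2 * Real.pi * (2 * (t : ℂ)) + b * 1))) (t : ℂ) := by
        refine (p.hasDerivAt _).mul (HasDerivAt.cexp ?_)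
        refine HasDerivAt.add (HasDerivAt.const_mul _ ?_) ((hasDerivAt_id _).const_mul b)
        simpa using hasDerivAt_pow 2 (t : ℂ)
      refine h1.comp_ofReal.congr_deriv ?_
      simp only [Polynomial.eval_sub, Polynomial.eval_mul, Polynomial.eval_C, Polynomial.eval_X]
      ring)
    (integrable_polynomial_mul_gaussian neg_two_pi_re b _)
    (integrable_polynomial_mul_gaussian neg_two_pi_re b _)
  change gaussianIntegral b _ = 0 at h
  rwa [gaussianIntegral_sub, gaussianIntegral_sub, gaussianIntegral_C_mul,
    gaussianIntegral_C_mul, sub_eq_zero] at h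

lemma gaussianIntegral_one (b : ℂ) :
    gaussianIntegral b 1 = (((2 : ℝ) ^ (-1 / 2 : ℝ) : ℝ) : ℂ) * cexp (b ^ 2 / (8 * Real.pi)) := by
  have hpi : (Real.pi : ℂ) ≠ 0 := by exact_mod_cast Real.pi_ne_zero
  have h := integral_cexp_quadratic neg_two_pi_re b 0
  simp only [add_zero] at h
  simp only [gaussianIntegral, Polynomial.eval_one, one_mul, h]
  have h1 : (Real.pi / -(-2 * Real.pi) : ℂ) = (((2 : ℝ)⁻¹ : ℝ) : ℂ) := by
    push_cast
    field_simp
  rw [h1, show (1 / 2 : ℂ) = ((1 / 2 : ℝ) : ℂ) by push_cast; rfl,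
    ← Complex.ofReal_cpow (by positivity), Real.inv_rpow (by positivity), neg_div,
    Real.rpow_neg (by positivity)]
  congr 2
  field_simp
  ring

/-- The monic orthogonal polynomials with respect to `e^{-2πt²}`. -/
noncomputable def monicHermite : ℕ → Polynomial ℝ
  | 0 => 1
  | n + 1 => Polynomial.X * monicHermite n -
      Polynomial.C (4 * Real.pi)⁻¹ * Polynomial.derivative (monicHermite n)

lemma monicHermite_monic_natDegree (n : ℕ) :
    (monicHermite n).Monic ∧ (monicHermite n).natDegree = n := by
  induction n with
  | zero => exact ⟨Polynomial.monic_one, Polynomial.natDegree_one⟩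
  | succ n ih =>
    obtain ⟨hm, hd⟩ := ih
    have hXm : (Polynomial.X * monicHermite n).Monic := Polynomial.monic_X.mul hm
    have hXd : (Polynomial.X * monicHermite n).degree = ((n + 1 : ℕ) : WithBot ℕ) := by
      rw [Polynomial.degree_mul, Polynomial.degree_X, Polynomial.degree_eq_natDegree hm.ne_zero, hd]
      push_cast
      ring
    have hlt : (Polynomial.C (4 * Real.pi)⁻¹ * Polynomial.derivative (monicHermite n)).degree <
        (Polynomial.X * monicHermite n).degree := by
      rw [hXd, Polynomial.degree_C_mul (by positivity)]
      refine (Polynomial.degree_derivative_le).trans_lt ?_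
      rw [Polynomial.degree_eq_natDegree hm.ne_zero, hd]
      exact_mod_cast Nat.lt_succ_self n
    refine ⟨hXm.sub_of_left hlt, Polynomial.natDegree_eq_of_degree_eq_some ?_⟩
    rw [monicHermite, Polynomial.degree_sub_eq_left_of_degree_lt hlt, hXd]

/-- By integration by parts, passing from `p` to `X p - p' / (4π)`, which is the recursion of
`monicHermite`, multiplies the integral by `b / (4π)`. -/
lemma gaussianIntegral_monicHermite (b : ℂ) (n : ℕ) :
    gaussianIntegral b ((monicHermite n).map ofRealHom) =
      (b / (4 * Real.pi)) ^ n * gaussianIntegral b 1 := by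
  have hpi : (Real.pi : ℂ) ≠ 0 := by exact_mod_cast Real.pi_ne_zero
  induction n with
  | zero => simp [monicHermite]
  | succ n ih =>
    rw [monicHermite, Polynomial.map_sub, Polynomial.map_mul, Polynomial.map_mul,
      Polynomial.map_X, Polynomial.map_C, ← Polynomial.derivative_map, gaussianIntegral_sub,
      gaussianIntegral_C_mul, gaussianIntegral_derivative, ih]
    simp only [ofRealHom_eq_coe]
    push_cast
    rw [pow_succ]
    generalize (b / (4 * Real.pi)) ^ n = x
    field_simp
    ring

/-- Without a linear term in the exponent, `p ↦ X p - p' / (4π)` is adjoint to differentiation up to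
the factor `(4π)⁻¹`. Orthogonality and the norm of `monicHermite` both follow, since `n` derivatives
kill lower degrees and send a monic polynomial of degree `n` to `n!`. -/
lemma gaussianIntegral_monicHermite_mul (n : ℕ) (q : Polynomial ℂ) :
    gaussianIntegral 0 ((monicHermite n).map ofRealHom * q) =
      ((4 * Real.pi : ℂ)⁻¹) ^ n * gaussianIntegral 0 (Polynomial.derivative^[n] q) := by
  have hpi : (Real.pi : ℂ) ≠ 0 := by exact_mod_cast Real.pi_ne_zero
  induction n generalizing q with
  | zero => simp [monicHermite]
  | succ n ih =>
    have h := gaussianIntegral_derivative 0 ((monicHermite n).map ofRealHom * q)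
    rw [Polynomial.derivative_mul, gaussianIntegral_add, ih, zero_mul, sub_zero] at h
    rw [monicHermite, Polynomial.map_sub, Polynomial.map_mul, Polynomial.map_mul,
      Polynomial.map_X, Polynomial.map_C, ← Polynomial.derivative_map, sub_mul,
      gaussianIntegral_sub, mul_assoc, mul_assoc, gaussianIntegral_C_mul, Function.iterate_succ,
      Function.comp_apply, pow_succ]
    simp only [ofRealHom_eq_coe]
    push_cast
    rw [show gaussianIntegral 0 (Polynomial.X * ((monicHermite n).map ofRealHom * q)) =
      (4 * Real.pi : ℂ)⁻¹ * (4 * Real.pi *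
        gaussianIntegral 0 (Polynomial.X * ((monicHermite n).map ofRealHom * q))) by
        field_simp, ← h]
    ring

lemma gaussianIntegral_monicHermite_mul_self (n : ℕ) :
    gaussianIntegral 0 ((monicHermite n).map ofRealHom * (monicHermite n).map ofRealHom) =
      ((4 * Real.pi : ℂ)⁻¹) ^ n * (n.factorial * gaussianIntegral 0 1) := by
  obtain ⟨hm, hd⟩ := monicHermite_monic_natDegree n
  have hm' : ((monicHermite n).map ofRealHom).Monic := hm.map _
  have hd' : ((monicHermite n).map ofRealHom).natDegree = n := by rw [hm.natDegree_map, hd]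
  have h : Polynomial.derivative^[n] ((monicHermite n).map ofRealHom) =
      Polynomial.C (n.factorial : ℂ) * 1 := by
    rw [Polynomial.eq_C_of_natDegree_le_zero
      (p := Polynomial.derivative^[n] ((monicHermite n).map ofRealHom))
      ((Polynomial.natDegree_iterate_derivative _ n).trans (by rw [hd', Nat.sub_self])),
      Polynomial.coeff_iterate_derivative, zero_add, Nat.descFactorial_self]
    have : ((monicHermite n).map ofRealHom).coeff n = 1 := by
      nth_rw 2 [← hd']
      exact hm'
    rw [this]
    simp
  rw [gaussianIntegral_monicHermite_mul, h, gaussianIntegral_C_mul]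

lemma ofReal_integral_mul_exp (p : Polynomial ℝ) :
    ((∫ t : ℝ, p.eval t * Real.exp (-2 * Real.pi * t ^ 2) : ℝ) : ℂ) =
      gaussianIntegral 0 (p.map ofRealHom) := by
  rw [← integral_complex_ofReal, gaussianIntegral]
  refine integral_congr_ae (Filter.Eventually.of_forall fun t => ?_)
  have : (p.map ofRealHom).eval (t : ℂ) = ((p.eval t : ℝ) : ℂ) :=
    Polynomial.eval_map_apply (f := ofRealHom) t
  simp [this]

lemma integral_monicHermite_mul_eq_zero {n : ℕ} {q : Polynomial ℝ} (hq : q.degree < n) :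
    ∫ t : ℝ, (monicHermite n * q).eval t * Real.exp (-2 * Real.pi * t ^ 2) = 0 := by
  rw [← Complex.ofReal_inj, ofReal_integral_mul_exp, Polynomial.map_mul,
    gaussianIntegral_monicHermite_mul]
  have : Polynomial.derivative^[n] (q.map ofRealHom) = 0 := by
    rcases eq_or_ne q 0 with rfl | h0
    · simp
    · refine Polynomial.iterate_derivative_eq_zero ?_
      refine Polynomial.natDegree_map_le.trans_lt ?_
      rwa [← Polynomial.natDegree_lt_iff_degree_lt h0] at hq
  rw [this]
  simp [gaussianIntegral]

/-- The difference `D` of the two sides has degree below `k`, so it is orthogonal to both of them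
and hence to itself. A continuous nonnegative function with zero integral vanishes. -/
lemma IsOrthogonalPolynomial.eq_C_mul_monicHermite {k : ℕ} {H : Polynomial ℝ}
    (hH : IsOrthogonalPolynomial k H) :
    H = Polynomial.C H.leadingCoeff * monicHermite k := by
  obtain ⟨hdeg, horth⟩ := hH
  obtain ⟨hm, hd⟩ := monicHermite_monic_natDegree k
  have hH0 : H ≠ 0 := fun h => by simp [h] at hdeg
  have hl : H.leadingCoeff ≠ 0 := Polynomial.leadingCoeff_ne_zero.2 hH0
  set D := H - Polynomial.C H.leadingCoeff * monicHermite k with hD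
  have hDdeg : D.degree < k := by
    rw [← hdeg]
    refine Polynomial.degree_sub_lt_left ?_ hH0 ?_
    · rw [Polynomial.degree_C_mul hl, Polynomial.degree_eq_natDegree hm.ne_zero, hd, hdeg]
    · rw [Polynomial.leadingCoeff_mul, hm.leadingCoeff, mul_one, Polynomial.leadingCoeff_C]
  have hint : ∀ p : Polynomial ℝ,
      Integrable fun t : ℝ => p.eval t * Real.exp (-2 * Real.pi * t ^ 2) := by
    intro p
    refine (integrable_polynomial_mul_gaussian neg_two_pi_re 0 (p.map ofRealHom)).re.congr
      (Filter.Eventually.of_forall fun t => ?_)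
    have : (p.map ofRealHom).eval (t : ℂ) = ((p.eval t : ℝ) : ℂ) :=
      Polynomial.eval_map_apply (f := ofRealHom) t
    simp only [this, zero_mul, add_zero]
    rw [show (-2 * Real.pi * (t : ℂ) ^ 2) = ((-2 * Real.pi * t ^ 2 : ℝ) : ℂ) by push_cast; rfl,
      ← Complex.ofReal_exp, ← Complex.ofReal_mul]
    exact Complex.ofReal_re _
  have hzero : ∫ t : ℝ, (D * D).eval t * Real.exp (-2 * Real.pi * t ^ 2) = 0 := by
    have h1 := horth D hDdeg
    have h2 := integral_monicHermite_mul_eq_zero hDdeg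
    have h3 : ∀ t : ℝ, (D * D).eval t * Real.exp (-2 * Real.pi * t ^ 2) =
        (H * D).eval t * Real.exp (-2 * Real.pi * t ^ 2) - H.leadingCoeff *
          ((monicHermite k * D).eval t * Real.exp (-2 * Real.pi * t ^ 2)) := by
      intro t
      have : D.eval t = H.eval t - H.leadingCoeff * (monicHermite k).eval t := by simp [hD]
      rw [Polynomial.eval_mul, Polynomial.eval_mul, Polynomial.eval_mul]
      nth_rw 1 [this]
      ring
    simp_rw [h3]
    rw [integral_sub (hint _) ((hint _).const_mul _), integral_const_mul, h2]
    simp only [Polynomial.eval_mul]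
    rw [h1]
    simp
  rw [integral_eq_zero_iff_of_nonneg (fun t => by
    simp only [Polynomial.eval_mul]
    exact mul_nonneg (mul_self_nonneg _) (Real.exp_pos _).le) (hint _),
    Continuous.ae_eq_iff_eq _ (by fun_prop) continuous_zero] at hzero
  have hD0 : D = 0 := Polynomial.funext fun t => by
    have := congrFun hzero t
    simpa [Real.exp_ne_zero] using this
  exact sub_eq_zero.1 hD0

lemma two_rpow_fourth_mul_self_mul :
    (2 : ℝ) ^ (1 / 4 : ℝ) * (2 : ℝ) ^ (1 / 4 : ℝ) * (2 : ℝ) ^ (-1 / 2 : ℝ) = 1 := by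
  rw [← Real.rpow_add two_pos, ← Real.rpow_add two_pos]
  norm_num

/-- The Bargmann transform of the `k`-th Hermite function is a normalized monomial. -/
theorem IsHermiteFunction.bargmann_eq {k : ℕ} {h : Lp ℂ 2 (volume : Measure ℝ)}
    (hh : IsHermiteFunction k h) :
    ∃ a : ℂ, ‖a‖ ^ 2 = Real.pi ^ k / k.factorial ∧ ∀ w, bargmann (h : 𝓢'(ℝ, ℂ)) w = a * w ^ k := by
  obtain ⟨hnorm, H, c, hH, hc⟩ := hh
  have hHe := hH.eq_C_mul_monicHermite
  set ℓ := H.leadingCoeff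
  set r : ℝ := (2 : ℝ) ^ (1 / 4 : ℝ) with hr
  have hrc : (r : ℂ) * r * (((2 : ℝ) ^ (-1 / 2 : ℝ) : ℝ) : ℂ) = 1 := by
    exact_mod_cast two_rpow_fourth_mul_self_mul
  have hpi : (Real.pi : ℂ) ≠ 0 := by exact_mod_cast Real.pi_ne_zero
  have hev : ∀ t : ℝ, ((H.eval t : ℝ) : ℂ) =
      ℓ * ((monicHermite k).map ofRealHom).eval (t : ℂ) := by
    intro t
    have : ((monicHermite k).map ofRealHom).eval (t : ℂ) = (((monicHermite k).eval t : ℝ) : ℂ) :=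
      Polynomial.eval_map_apply (f := ofRealHom) t
    rw [this, hHe]
    simp
  -- Pairing with the window translated by `w` gives the linear coefficient `b = 2πw`, so `(b /
  -- (4π)) ^ k = (w / 2) ^ k`. The powers of 2 in the windows and in the Gaussian integral cancel
  -- (`hrc`).
  refine ⟨c * ℓ * (1 / 2) ^ k, ?_, fun w => ?_⟩
  · have h1 : (1 : ℂ) = ∫ t : ℝ, inner ℂ (h t) (h t) := by
      rw [← L2.inner_def, inner_self_eq_norm_sq_to_K, hnorm]
      simp
    have h2 : ∫ t : ℝ, inner ℂ (h t) (h t) = (‖c‖ ^ 2 * ℓ ^ 2 * (r * r) : ℂ) *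
        gaussianIntegral 0 ((monicHermite k).map ofRealHom * (monicHermite k).map ofRealHom) := by
      rw [gaussianIntegral, ← integral_const_mul]
      refine integral_congr_ae (hc.mono fun t ht => ?_)
      simp only
      rw [ht, inner_self_eq_norm_sq_to_K, norm_mul, Complex.norm_real]
      change ((‖c‖ * ‖H.eval t * gaussianWindow t‖ : ℝ) : ℂ) ^ 2 = _
      rw [Real.norm_eq_abs, ← Complex.ofReal_pow, mul_pow, sq_abs]
      push_cast
      rw [mul_pow, hev, gaussianWindow, ← hr]
      push_cast
      rw [Polynomial.eval_mul, zero_mul, add_zero,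
        show (-2 * Real.pi * (t : ℂ) ^ 2) = -Real.pi * t ^ 2 + -Real.pi * t ^ 2 by ring,
        Complex.exp_add]
      ring
    rw [h2, gaussianIntegral_monicHermite_mul_self, gaussianIntegral_one] at h1
    simp only [ne_eq, OfNat.ofNat_ne_zero, not_false_eq_true, zero_pow, zero_div, Complex.exp_zero,
      mul_one] at h1
    have h3 : (1 : ℂ) = ((‖c‖ ^ 2 * ℓ ^ 2 * (((4 * Real.pi)⁻¹) ^ k * k.factorial) : ℝ) : ℂ) := by
      rw [h1]
      push_cast
      linear_combination (‖c‖ ^ 2 * ℓ ^ 2 * (((4 * Real.pi : ℂ)⁻¹) ^ k * k.factorial)) * hrc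
    have h4 : 1 = ‖c‖ ^ 2 * ℓ ^ 2 * (((4 * Real.pi)⁻¹) ^ k * k.factorial) := by exact_mod_cast h3
    have hf : (k.factorial : ℝ) ≠ 0 := by exact_mod_cast k.factorial_ne_zero
    rw [norm_mul, norm_mul, norm_pow, mul_pow, mul_pow, Complex.norm_real, Real.norm_eq_abs,
      sq_abs, eq_div_iff hf]
    rw [mul_inv, mul_pow, inv_pow Real.pi] at h4
    have h5 : (‖(1 / 2 : ℂ)‖ ^ k) ^ 2 = ((4 : ℝ)⁻¹) ^ k := by
      rw [← pow_mul, mul_comm, pow_mul]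
      norm_num
    rw [h5]
    have hpk : Real.pi ^ k ≠ 0 := by positivity
    calc _ = (‖c‖ ^ 2 * ℓ ^ 2 * (((4 : ℝ)⁻¹) ^ k * (Real.pi ^ k)⁻¹ * k.factorial)) * Real.pi ^ k := by
          field_simp
      _ = Real.pi ^ k := by rw [← h4, one_mul]
  · have h1 : (h : 𝓢'(ℝ, ℂ)) (translatedWindow w) = (c * ℓ * (r * r) * cexp (-Real.pi * w ^ 2)) *
        gaussianIntegral (2 * Real.pi * w) ((monicHermite k).map ofRealHom) := by
      rw [Lp.toTemperedDistribution_apply, gaussianIntegral, ← integral_const_mul]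
      refine integral_congr_ae (hc.mono fun t ht => ?_)
      simp only [smul_eq_mul]
      rw [ht, translatedWindow_apply, entireWindow]
      simp only [gaussianWindow, ← hr]
      push_cast
      rw [hev, show -Real.pi * ((t : ℂ) - w) ^ 2 = -Real.pi * w ^ 2 + (2 * Real.pi * w * t +
        -Real.pi * t ^ 2) by ring, show -2 * Real.pi * (t : ℂ) ^ 2 + 2 * Real.pi * w * t =
        -Real.pi * t ^ 2 + (2 * Real.pi * w * t + -Real.pi * t ^ 2) by ring,
        Complex.exp_add _ (2 * Real.pi * w * t + -Real.pi * t ^ 2),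
        Complex.exp_add _ (2 * Real.pi * w * t + -Real.pi * t ^ 2)]
      ring
    rw [bargmann, h1, gaussianIntegral_monicHermite, gaussianIntegral_one]
    have h2 : cexp (Real.pi * w ^ 2 / 2) * cexp (-Real.pi * w ^ 2) *
        cexp ((2 * Real.pi * w) ^ 2 / (8 * Real.pi)) = 1 := by
      rw [← Complex.exp_add, ← Complex.exp_add, Complex.exp_eq_one_iff]
      refine ⟨0, ?_⟩
      field_simp
      ring
    have h3 : (2 * Real.pi * w / (4 * Real.pi) : ℂ) = 1 / 2 * w := by
      field_simp
      ring
    rw [h3, mul_pow]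
    linear_combination (c * ℓ * (1 / 2) ^ k * w ^ k) * h2 + (c * ℓ * (1 / 2) ^ k * w ^ k *
      (cexp (Real.pi * w ^ 2 / 2) * cexp (-Real.pi * w ^ 2) *
        cexp ((2 * Real.pi * w) ^ 2 / (8 * Real.pi)))) * hrc

/-! ### The circular complex Gaussian distribution -/

/-- The standard circular complex Gaussian distribution, with density `π⁻¹ e^{-|z|²}`. -/
noncomputable def circularGaussian : Measure ℂ :=
  volume.withDensity fun z => ENNReal.ofReal (Real.pi⁻¹ * Real.exp (-1 * ‖z‖ ^ 2))

lemma lintegral_exp_neg_mul_sq_norm {b : ℝ} (hb : 0 < b) :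
    ∫⁻ z : ℂ, ENNReal.ofReal (Real.exp (-b * ‖z‖ ^ 2)) = ENNReal.ofReal (Real.pi / b) := by
  have h := GaussianFourier.integral_rexp_neg_mul_sq_norm (V := ℂ) hb
  have hi : Integrable (fun z : ℂ => Real.exp (-b * ‖z‖ ^ 2)) := by
    have := (GaussianFourier.integrable_cexp_neg_mul_sq_norm_add (V := ℂ) (b := (b : ℂ))
      (by simpa using hb) 0 0).re
    refine this.congr (Filter.Eventually.of_forall fun z => ?_)
    simp only [zero_mul, add_zero]
    rw [show -(b : ℂ) * ((‖z‖ : ℝ) : ℂ) ^ 2 = ((-b * ‖z‖ ^ 2 : ℝ) : ℂ) by push_cast; ring,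
      ← Complex.ofReal_exp]
    exact Complex.ofReal_re _
  rw [← ofReal_integral_eq_lintegral_ofReal hi (Filter.Eventually.of_forall fun z =>
    (Real.exp_pos _).le), h]
  simp

instance : IsProbabilityMeasure circularGaussian := by
  constructor
  rw [circularGaussian, withDensity_apply _ MeasurableSet.univ, Measure.restrict_univ]
  simp_rw [ENNReal.ofReal_mul (inv_nonneg.2 Real.pi_pos.le)]
  rw [lintegral_const_mul _ (by fun_prop), lintegral_exp_neg_mul_sq_norm one_pos, div_one,
    ← ENNReal.ofReal_mul (inv_nonneg.2 Real.pi_pos.le), inv_mul_cancel₀ Real.pi_ne_zero,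
    ENNReal.ofReal_one]

lemma charFun_circularGaussian (t : ℂ) :
    charFun circularGaussian t = cexp (-(‖t‖ : ℂ) ^ 2 / 4) := by
  rw [charFun_apply, circularGaussian, integral_withDensity_eq_integral_toReal_smul
    (by fun_prop) (Filter.Eventually.of_forall fun _ => ENNReal.ofReal_lt_top)]
  have h := GaussianFourier.integral_cexp_neg_mul_sq_norm_add (V := ℂ) (b := 1) (by simp) I t
  have h2 : ∀ z : ℂ, (ENNReal.ofReal (Real.pi⁻¹ * Real.exp (-1 * ‖z‖ ^ 2))).toReal •
      cexp ((inner ℝ z t : ℝ) * I) =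
      (Real.pi : ℂ)⁻¹ * cexp (-1 * (‖z‖ : ℂ) ^ 2 + I * (inner ℝ t z : ℝ)) := by
    intro z
    rw [ENNReal.toReal_ofReal (by positivity), Complex.real_smul, Complex.exp_add,
      real_inner_comm, mul_comm I]
    push_cast
    ring
  simp_rw [h2]
  rw [integral_const_mul, h, Complex.finrank_real_complex, div_one]
  norm_num

/-- A random variable whose characteristic function is that of the circular Gaussian. -/
lemma map_eq_circularGaussian {Ω : Type*} [MeasurableSpace Ω] {P : Measure Ω}
    [IsProbabilityMeasure P] {Z : Ω → ℂ} (hZ : Measurable Z)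
    (h : ∀ t : ℂ, ∫ ω, cexp (I * ((t * Z ω).re : ℂ)) ∂P = cexp (-(‖t‖ : ℂ) ^ 2 / 4)) :
    P.map Z = circularGaussian := by
  have : IsProbabilityMeasure (P.map Z) := Measure.isProbabilityMeasure_map hZ.aemeasurable
  refine Measure.ext_of_charFun (funext fun t => ?_)
  rw [charFun_circularGaussian, charFun_apply, integral_map hZ.aemeasurable
    (by fun_prop)]
  have := h (starRingEnd ℂ t)
  rw [RCLike.norm_conj] at this
  rw [← this]
  refine integral_congr_ae (Filter.Eventually.of_forall fun ω => ?_)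
  simp only [mul_comm I]
  congr 3
  rw [real_inner_comm, Complex.inner, mul_comm]

/-- The density is at most `π⁻¹` and the disc has area `π r ^ 2`. -/
lemma circularGaussian_closedBall_le (a : ℂ) {r : ℝ} (hr : 0 ≤ r) :
    circularGaussian (Metric.closedBall a r) ≤ ENNReal.ofReal (r ^ 2) := by
  rw [circularGaussian, withDensity_apply _ Metric.isClosed_closedBall.measurableSet]
  calc _ ≤ ∫⁻ z in Metric.closedBall a r, ENNReal.ofReal Real.pi⁻¹ := by
        refine lintegral_mono fun z => ENNReal.ofReal_le_ofReal ?_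
        refine mul_le_of_le_one_right (inv_nonneg.2 Real.pi_pos.le) ?_
        rw [Real.exp_le_one_iff]
        nlinarith [sq_nonneg ‖z‖]
    _ = _ := by
        rw [lintegral_const, Measure.restrict_apply MeasurableSet.univ, Set.univ_inter,
          Complex.volume_closedBall]
        rw [← ENNReal.ofReal_pow hr, mul_comm, mul_assoc]
        rw [show ((NNReal.pi : NNReal) : ℝ≥0∞) = ENNReal.ofReal Real.pi by
          rw [← NNReal.coe_real_pi, ENNReal.ofReal_coe_nnreal]]
        rw [← ENNReal.ofReal_mul Real.pi_pos.le, mul_inv_cancel₀ Real.pi_ne_zero]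
        simp

lemma lintegral_exp_circularGaussian :
    ∫⁻ z, ENNReal.ofReal (Real.exp (3 / 4 * ‖z‖ ^ 2)) ∂circularGaussian = 4 := by
  rw [circularGaussian, lintegral_withDensity_eq_lintegral_mul _ (by fun_prop) (by fun_prop)]
  have : ∀ z : ℂ, ((fun z : ℂ => ENNReal.ofReal (Real.pi⁻¹ * Real.exp (-1 * ‖z‖ ^ 2))) *
      fun z : ℂ => ENNReal.ofReal (Real.exp (3 / 4 * ‖z‖ ^ 2))) z =
      ENNReal.ofReal Real.pi⁻¹ * ENNReal.ofReal (Real.exp (-(1 / 4) * ‖z‖ ^ 2)) := by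
    intro z
    rw [Pi.mul_apply, ← ENNReal.ofReal_mul (by positivity), ← ENNReal.ofReal_mul (by positivity),
      mul_assoc, ← Real.exp_add]
    ring_nf
  simp_rw [this]
  rw [lintegral_const_mul _ (by fun_prop), lintegral_exp_neg_mul_sq_norm (by norm_num),
    ← ENNReal.ofReal_mul (by positivity)]
  rw [show Real.pi⁻¹ * (Real.pi / (1 / 4)) = 4 by field_simp]
  norm_num

/-! ### Maximal inequality on a circle -/

/-- A mean value inequality for `exp (b |F|²)`, obtained from Cauchy's formula for
`z ↦ exp (2 b F(z) conj F(w))`. -/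
lemma exp_mul_sq_norm_le {F : ℂ → ℂ} (hF : Differentiable ℂ F) {b r : ℝ} (hb : 0 ≤ b) {w : ℂ}
    (hw : ‖w‖ < r) :
    Real.exp (b * ‖F w‖ ^ 2) ≤ r / (r - ‖w‖) * ((2 * Real.pi)⁻¹ *
      ∫ θ in (0 : ℝ)..2 * Real.pi, Real.exp (b * ‖F (circleMap 0 r θ)‖ ^ 2)) := by
  have hr : 0 < r := (norm_nonneg w).trans_lt hw
  set a : ℂ := 2 * b * (starRingEnd ℂ) (F w) with ha
  set G : ℂ → ℂ := fun z => cexp (a * F z) with hG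
  have hGd : Differentiable ℂ G := by fun_prop
  have hGw : ‖G w‖ = Real.exp (b * ‖F w‖ ^ 2) * Real.exp (b * ‖F w‖ ^ 2) := by
    rw [hG, ← Real.exp_add, Complex.norm_exp, ha]
    congr 1
    rw [mul_assoc, mul_comm (starRingEnd ℂ _), Complex.mul_conj, Complex.normSq_eq_norm_sq,
      ← Complex.ofReal_ofNat, ← Complex.ofReal_mul, ← Complex.ofReal_mul, Complex.ofReal_re]
    ring
  have hGz : ∀ z, ‖G z‖ ≤ Real.exp (b * ‖F w‖ ^ 2) * Real.exp (b * ‖F z‖ ^ 2) := by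
    intro z
    -- `2 ‖F w‖ ‖F z‖ ≤ ‖F w‖ ^ 2 + ‖F z‖ ^ 2`. At `z = w` the bound is an equality, so one factor
    -- `exp (b ‖F w‖ ^ 2)` cancels at the end.
    rw [hG, ← Real.exp_add, Complex.norm_exp, Real.exp_le_exp]
    refine (Complex.re_le_norm _).trans ?_
    rw [ha]
    simp only [norm_mul, RCLike.norm_conj, Complex.norm_ofNat, Complex.norm_real,
      Real.norm_of_nonneg hb]
    nlinarith [mul_nonneg hb (sq_nonneg (‖F w‖ - ‖F z‖))]
  have hc := Complex.two_pi_I_inv_smul_circleIntegral_sub_inv_smul_of_differentiable_on_off_countable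
    (f := G) (c := 0) (R := r) (w := w) Set.countable_empty (by simpa using hw)
    hGd.continuous.continuousOn (fun x _ => hGd x)
  have hcont : Continuous fun θ : ℝ => Real.exp (b * ‖F (circleMap 0 r θ)‖ ^ 2) := by
    have := hF.continuous
    fun_prop
  have hint : ‖∮ z in C(0, r), (z - w)⁻¹ • G z‖ ≤ ∫ θ in (0 : ℝ)..2 * Real.pi,
      r / (r - ‖w‖) * Real.exp (b * ‖F w‖ ^ 2) * Real.exp (b * ‖F (circleMap 0 r θ)‖ ^ 2) := by
    rw [circleIntegral]
    refine intervalIntegral.norm_integral_le_of_norm_le Real.two_pi_pos.le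
      (Filter.Eventually.of_forall fun θ _ => ?_) ((hcont.const_mul _).intervalIntegrable _ _)
    rw [norm_smul, norm_smul, deriv_circleMap, norm_inv]
    have h1 : r - ‖w‖ ≤ ‖circleMap 0 r θ - w‖ := by
      refine le_trans (le_of_eq ?_) (norm_sub_norm_le _ _)
      simp [abs_of_pos hr]
    have h2 : ‖circleMap 0 r θ * I‖ = r := by simp [abs_of_pos hr]
    rw [h2]
    calc r * (‖circleMap 0 r θ - w‖⁻¹ * ‖G (circleMap 0 r θ)‖) ≤ r * ((r - ‖w‖)⁻¹ *
          (Real.exp (b * ‖F w‖ ^ 2) * Real.exp (b * ‖F (circleMap 0 r θ)‖ ^ 2))) := by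
          have := sub_pos.2 hw
          have := hGz (circleMap 0 r θ)
          gcongr
      _ = _ := by ring
  rw [intervalIntegral.integral_const_mul] at hint
  have h3 : ‖G w‖ ≤ (2 * Real.pi)⁻¹ * (r / (r - ‖w‖) * Real.exp (b * ‖F w‖ ^ 2) *
      ∫ θ in (0 : ℝ)..2 * Real.pi, Real.exp (b * ‖F (circleMap 0 r θ)‖ ^ 2)) := by
    rw [← hc, norm_smul]
    have : ‖(2 * Real.pi * I : ℂ)⁻¹‖ = (2 * Real.pi)⁻¹ := by
      simp [abs_of_pos Real.pi_pos]
    rw [this]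
    gcongr
  rw [hGw] at h3
  refine le_of_mul_le_mul_left (h3.trans (le_of_eq ?_)) (Real.exp_pos (b * ‖F w‖ ^ 2))
  ring

/-- A maximal inequality for random entire functions with a uniform exponential moment on a
circle. -/
lemma measure_exists_sphere_le {Ω : Type*} [MeasurableSpace Ω] {P : Measure Ω}
    [IsProbabilityMeasure P] {F : Ω → ℂ → ℂ} (hF : ∀ ω, Differentiable ℂ (F ω))
    (hm : ∀ w, Measurable fun ω => F ω w) {b r R K : ℝ} (hb : 0 ≤ b) (hR : 0 ≤ R) (hr : R < r)
    (hexp : ∀ w, ‖w‖ = r →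
      ∫⁻ ω, ENNReal.ofReal (Real.exp (b * ‖F ω w‖ ^ 2)) ∂P ≤ ENNReal.ofReal K) (v : ℝ)
    (hv : 0 ≤ v) :
    P {ω | ∃ w, ‖w‖ = R ∧ v ≤ ‖F ω w‖} ≤
      ENNReal.ofReal (r / (r - R) * K / Real.exp (b * v ^ 2)) := by
  have hrpos : 0 < r := hR.trans_lt hr
  have hrR : 0 < r - R := sub_pos.2 hr
  set Φ : Ω → ℝ≥0∞ := fun ω => ∫⁻ θ in Set.Ioc (0 : ℝ) (2 * Real.pi),
    ENNReal.ofReal (Real.exp (b * ‖F ω (circleMap 0 r θ)‖ ^ 2)) with hΦ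
  have hmeas : Measurable fun p : Ω × ℝ => F p.1 (circleMap 0 r p.2) := by
    have h1 : Measurable (Function.uncurry fun (θ : ℝ) (ω : Ω) => F ω (circleMap 0 r θ)) :=
      measurable_uncurry_of_continuous_of_measurable
        (fun ω => (hF ω).continuous.comp (continuous_circleMap 0 r)) (fun θ => hm _)
    exact h1.comp measurable_swap
  have hmeas' : Measurable fun p : Ω × ℝ =>
      ENNReal.ofReal (Real.exp (b * ‖F p.1 (circleMap 0 r p.2)‖ ^ 2)) :=
    ((hmeas.norm.pow_const 2).const_mul b).exp.ennreal_ofReal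
  have hΦint : ∫⁻ ω, Φ ω ∂P ≤ ENNReal.ofReal (2 * Real.pi * K) := by
    rw [hΦ, lintegral_lintegral_swap hmeas'.aemeasurable]
    calc _ ≤ ∫⁻ θ in Set.Ioc (0 : ℝ) (2 * Real.pi), ENNReal.ofReal K :=
          lintegral_mono fun θ => hexp _ (by simp [abs_of_pos hrpos])
      _ = _ := by
          rw [lintegral_const, Measure.restrict_apply MeasurableSet.univ, Set.univ_inter,
            Real.volume_Ioc, sub_zero, mul_comm, ENNReal.ofReal_mul Real.two_pi_pos.le]
  set c : ℝ := 2 * Real.pi * ((r - R) / r) * Real.exp (b * v ^ 2) with hc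
  have hcpos : 0 < c := by positivity
  -- The event on the left need not be measurable. Only its outer measure is bounded, through a
  -- superlevel set of the measurable function `Φ`.
  have hsub : {ω | ∃ w, ‖w‖ = R ∧ v ≤ ‖F ω w‖} ⊆ {ω | ENNReal.ofReal c ≤ Φ ω} := by
    rintro ω ⟨w, hw, hvw⟩
    have h1 := exp_mul_sq_norm_le (hF ω) hb (hw.trans_lt hr)
    have hcont : Continuous fun θ : ℝ => Real.exp (b * ‖F ω (circleMap 0 r θ)‖ ^ 2) := by
      have := (hF ω).continuous
      fun_prop
    have h2 : Φ ω = ENNReal.ofReal (∫ θ in (0 : ℝ)..2 * Real.pi,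
        Real.exp (b * ‖F ω (circleMap 0 r θ)‖ ^ 2)) := by
      rw [intervalIntegral.integral_of_le Real.two_pi_pos.le,
        ofReal_integral_eq_lintegral_ofReal ((hcont.integrableOn_Icc).mono_set
          Set.Ioc_subset_Icc_self) (Filter.Eventually.of_forall fun θ => (Real.exp_pos _).le)]
    rw [Set.mem_ofPred_eq, h2]
    refine ENNReal.ofReal_le_ofReal ?_
    rw [hw] at h1
    have h3 : Real.exp (b * v ^ 2) ≤ Real.exp (b * ‖F ω w‖ ^ 2) := by gcongr
    set J := ∫ θ in (0 : ℝ)..2 * Real.pi, Real.exp (b * ‖F ω (circleMap 0 r θ)‖ ^ 2)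
    calc c ≤ 2 * Real.pi * ((r - R) / r) * (r / (r - R) * ((2 * Real.pi)⁻¹ * J)) := by
          rw [hc]; gcongr; exact h3.trans h1
      _ = J := by field_simp
  have hmark := mul_meas_ge_le_lintegral₀ (μ := P) (f := Φ)
    (Measurable.lintegral_prod_right' (f := fun p : Ω × ℝ =>
      ENNReal.ofReal (Real.exp (b * ‖F p.1 (circleMap 0 r p.2)‖ ^ 2))) hmeas').aemeasurable
    (ENNReal.ofReal c)
  refine (measure_mono hsub).trans ?_
  have h4 : P {ω | ENNReal.ofReal c ≤ Φ ω} ≤ ENNReal.ofReal (2 * Real.pi * K) /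
      ENNReal.ofReal c := by
    rw [ENNReal.le_div_iff_mul_le (Or.inl (by simpa using hcpos)) (Or.inl ENNReal.ofReal_ne_top),
      mul_comm]
    exact hmark.trans hΦint
  refine h4.trans (le_of_eq ?_)
  rw [← ENNReal.ofReal_div_of_pos hcpos, hc]
  congr 1
  field_simp

/-! ### Rouché's theorem for a monomial -/

/-- An entire function is divisible by the monic polynomial with simple roots at any finite set of
its zeros. -/
lemma exists_eq_prod_sub_mul {f : ℂ → ℂ} (hf : Differentiable ℂ f) (Z : Finset ℂ)
    (hZ : ∀ a ∈ Z, f a = 0) :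
    ∃ u : ℂ → ℂ, Differentiable ℂ u ∧ ∀ z, f z = (∏ a ∈ Z, (z - a)) * u z := by
  classical
  induction Z using Finset.induction_on with
  | empty => exact ⟨f, hf, fun z => by simp⟩
  | insert a Z ha ih =>
    obtain ⟨u, hu, hfu⟩ := ih fun b hb => hZ b (Finset.mem_insert_of_mem hb)
    have hua : u a = 0 := by
      have h := hfu a
      rw [hZ a (Finset.mem_insert_self _ _), eq_comm, mul_eq_zero, Finset.prod_eq_zero_iff] at h
      refine h.resolve_left ?_
      rintro ⟨b, hb, hab⟩
      exact ha (sub_eq_zero.1 hab ▸ hb)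
    refine ⟨dslope u a, ?_, fun z => ?_⟩
    · rw [← differentiableOn_univ, Complex.differentiableOn_dslope Filter.univ_mem]
      exact hu.differentiableOn
    · rw [hfu, Finset.prod_insert ha, mul_comm (z - a), mul_assoc, ← smul_eq_mul (z - a),
        sub_smul_dslope, hua, sub_zero]

lemma finite_zeros_closedBall {f : ℂ → ℂ} (hf : Differentiable ℂ f) {w₀ : ℂ} (hw₀ : f w₀ ≠ 0)
    (R : ℝ) : {w | ‖w‖ ≤ R ∧ f w = 0}.Finite := by
  by_contra hinf
  have hsub : {w | ‖w‖ ≤ R ∧ f w = 0} ⊆ Metric.closedBall 0 R := fun w hw => by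
    simpa using hw.1
  obtain ⟨x, -, hx⟩ := Set.Infinite.exists_accPt_of_subset_isCompact hinf
    (isCompact_closedBall 0 R) hsub
  have han : AnalyticOnNhd ℂ f Set.univ := fun z _ => hf.analyticAt z
  refine hw₀ (han.eqOn_zero_of_preconnected_of_frequently_eq_zero isPreconnected_univ
    (Set.mem_univ x) ?_ (Set.mem_univ w₀))
  rw [accPt_iff_frequently_nhdsNE] at hx
  exact hx.mono fun z hz => hz.2

/-- Rouché's theorem for a perturbation of a monomial, in the case of simple zeros. -/
theorem encard_zeros_eq_of_norm_sub_lt {F : ℂ → ℂ} (hF : Differentiable ℂ F) {R : ℝ} (hR : 0 < R)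
    {c : ℂ} {k : ℕ} (hlt : ∀ w, ‖w‖ = R → ‖F w - c * w ^ k‖ < ‖c * w ^ k‖)
    (hsimple : ∀ w, ‖w‖ < R → F w = 0 → deriv F w ≠ 0) :
    {w | ‖w‖ < R ∧ F w = 0}.encard = k := by
  have hFR : ∀ w, ‖w‖ = R → F w ≠ 0 := fun w hw h0 => by
    have := hlt w hw
    simp [h0] at this
  have hcR : ∀ w, ‖w‖ = R → c * w ^ k ≠ 0 := fun w hw h0 => by
    have := hlt w hw
    rw [h0, norm_zero] at this
    exact absurd this (norm_nonneg _).not_gt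
  have hRnorm : ‖(R : ℂ)‖ = R := by simp [abs_of_pos hR]
  have hc : c ≠ 0 := left_ne_zero_of_mul (hcR R hRnorm)
  have hfin := finite_zeros_closedBall hF (hFR R hRnorm) R
  set Z := hfin.toFinset with hZdef
  have hZmem : ∀ w, w ∈ Z ↔ ‖w‖ < R ∧ F w = 0 := by
    intro w
    rw [hZdef, Set.Finite.mem_toFinset]
    refine ⟨fun h => ⟨lt_of_le_of_ne h.1 fun h' => hFR w h' h.2, h.2⟩, fun h => ⟨h.1.le, h.2⟩⟩
  obtain ⟨u, hu, hFu⟩ := exists_eq_prod_sub_mul hF Z fun a ha => ((hZmem a).1 ha).2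
  -- A zero of the cofactor `u` would be a zero of `F` already divided out once, hence a multiple
  -- one.
  have hu0 : ∀ w, ‖w‖ ≤ R → u w ≠ 0 := by
    intro w hw h0
    have hFw : F w = 0 := by rw [hFu, h0, mul_zero]
    have hwR : ‖w‖ < R := lt_of_le_of_ne hw fun h' => hFR w h' hFw
    have hwZ : w ∈ Z := (hZmem w).2 ⟨hwR, hFw⟩
    refine hsimple w hwR hFw ?_
    have hP : DifferentiableAt ℂ (fun z => ∏ a ∈ Z, (z - a)) w := by fun_prop
    rw [funext hFu, deriv_fun_mul hP (hu w), h0,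
      Finset.prod_eq_zero hwZ (sub_self w)]
    simp
  have hder : ∀ z, ‖z‖ = R → deriv F z / F z = ∑ a ∈ Z, (z - a)⁻¹ + deriv u z / u z := by
    intro z hz
    have hza : ∀ a ∈ Z, z - a ≠ 0 := fun a ha h => by
      have := ((hZmem a).1 ha).1
      rw [← sub_eq_zero.1 h, hz] at this
      exact lt_irrefl _ this
    have h1 := logDeriv_mul (f := fun z => ∏ a ∈ Z, (z - a)) (g := u) z
      (Finset.prod_ne_zero_iff.2 hza) (hu0 z hz.le) (by fun_prop) (hu z)
    rw [← funext hFu, logDeriv_apply] at h1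
    rw [h1, logDeriv_apply u]
    congr 1
    rw [logDeriv_prod (f := fun a z => z - a) hza (fun a _ => by fun_prop)]
    refine Finset.sum_congr rfl fun a _ => ?_
    simp [logDeriv_apply]
  -- On the circle the quotient `F z / (c z ^ k)` is at distance less than 1 from 1, so its
  -- principal logarithm is a primitive of the integrand. Computing the same integral from the
  -- factorization gives `2πi (Z.card - k)`.
  have hlog : ∮ z in C(0, R), (deriv F z / F z - k * (z - 0)⁻¹) = 0 := by
    refine circleIntegral.integral_eq_zero_of_hasDerivWithinAt
      (f := fun z => Complex.log (F z / (c * z ^ k))) hR.le fun z hz => ?_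
    have hzR : ‖z‖ = R := by simpa using hz
    have hz0 : z ≠ 0 := fun h => by rw [h, norm_zero] at hzR; exact hR.ne hzR
    have hq : HasDerivAt (fun z => F z / (c * z ^ k))
        ((deriv F z * (c * z ^ k) - F z * (c * (k * z ^ (k - 1)))) / (c * z ^ k) ^ 2) z :=
      (hF z).hasDerivAt.div ((hasDerivAt_pow k z).const_mul c) (hcR z hzR)
    have hslit : F z / (c * z ^ k) ∈ Complex.slitPlane := by
      refine Complex.mem_slitPlane_of_norm_lt_one (z := F z / (c * z ^ k) - 1) ?_ |> fun h => by
        simpa using h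
      rw [div_sub_one (hcR z hzR), norm_div, div_lt_one (norm_pos_iff.2 (hcR z hzR))]
      exact hlt z hzR
    have hd := hq.clog hslit
    refine (hd.congr_deriv ?_).hasDerivWithinAt
    have := hFR z hzR
    rcases Nat.eq_zero_or_pos k with rfl | hk
    · simp
      field_simp
    · have hzk : z ^ k = z ^ (k - 1) * z := by rw [← pow_succ, Nat.sub_add_cancel hk]
      rw [hzk, sub_zero]
      field_simp
  have hudiff : Differentiable ℂ (deriv u) := fun z => by
    have := (hu.analyticAt z).deriv
    exact this.differentiableAt
  have hu_int : ∮ z in C(0, R), deriv u z / u z = 0 := by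
    refine Complex.circleIntegral_eq_zero_of_differentiable_on_off_countable hR.le
      Set.countable_empty ?_ ?_
    · exact hudiff.continuous.continuousOn.div hu.continuous.continuousOn
        fun z hz => hu0 z (by simpa using hz)
    · exact fun z hz => (hudiff z).div (hu z) (hu0 z (by simpa using (Metric.mem_ball.1 hz.1).le))
  have hci : ∀ a, ‖a‖ < R → CircleIntegrable (fun z => (z - a)⁻¹) 0 R := fun a ha => by
    rw [circleIntegrable_sub_inv_iff]
    right
    simp only [Metric.mem_sphere, dist_zero_right, abs_of_pos hR]
    exact ha.ne
  have huci : CircleIntegrable (fun z => deriv u z / u z) 0 R := by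
    refine ContinuousOn.circleIntegrable hR.le ?_
    exact hudiff.continuous.continuousOn.div hu.continuous.continuousOn
        fun z hz => hu0 z (by rw [← dist_zero_right]; exact (Metric.mem_sphere.1 hz).le)
  have hmain : ∮ z in C(0, R), (deriv F z / F z - k * (z - 0)⁻¹) =
      ∮ z in C(0, R), ((∑ a ∈ Z, (z - a)⁻¹ + deriv u z / u z) - k * (z - 0)⁻¹) := by
    refine circleIntegral.integral_congr hR.le fun z hz => ?_
    have hzR : ‖z‖ = R := by simpa using hz
    simp only [hder z hzR]
  have hsum : CircleIntegrable (fun z => ∑ a ∈ Z, (z - a)⁻¹) 0 R :=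
    CircleIntegrable.fun_sum _ fun a ha => hci a ((hZmem a).1 ha).1
  have h0ci : CircleIntegrable (fun z => (k : ℂ) * (z - 0)⁻¹) 0 R :=
    (hci 0 (by simpa using hR)).const_mul _
  have hadd : CircleIntegrable (fun z => ∑ a ∈ Z, (z - a)⁻¹ + deriv u z / u z) 0 R :=
    hsum.add huci
  rw [hlog, circleIntegral.integral_sub hadd h0ci,
    circleIntegral.integral_add hsum huci, hu_int, add_zero,
    circleIntegral.integral_const_mul,
    circleIntegral.integral_sub_inv_of_mem_ball (by simpa using hR),
    circleIntegral.integral_fun_sum fun a ha => hci a ((hZmem a).1 ha).1,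
    Finset.sum_congr rfl fun a ha => circleIntegral.integral_sub_inv_of_mem_ball
      (by simpa using ((hZmem a).1 ha).1), Finset.sum_const, nsmul_eq_mul, ← sub_mul, eq_comm,
    mul_eq_zero, sub_eq_zero] at hmain
  have hcard : Z.card = k := by
    exact_mod_cast hmain.resolve_right (by simp [Real.pi_ne_zero])
  have hset : {w | ‖w‖ < R ∧ F w = 0} = (Z : Set ℂ) := by
    ext w
    exact (hZmem w).symm
  rw [hset, Set.encard_coe_eq_coe_finsetCard, hcard]

/-! ### Almost sure absence of double zeros -/

/-- The second derivative is bounded on the disc of radius `R + 1`. Taking the constant in `ℕ` lets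
a countable union cover all functions. -/
lemma exists_norm_le_mul_sq_of_double_zero {F : ℂ → ℂ} (hF : Differentiable ℂ F) (R : ℝ) :
    ∃ C : ℕ, ∀ w, ‖w‖ ≤ R → F w = 0 → deriv F w = 0 →
      ∀ z, ‖z - w‖ ≤ 1 → ‖F z‖ ≤ C * ‖z - w‖ ^ 2 := by
  have hd2 : Continuous (deriv (deriv F)) := hF.deriv.deriv.continuous
  obtain ⟨C₀, hC₀⟩ := (isCompact_closedBall (0 : ℂ) (R + 1)).exists_bound_of_continuousOn
    hd2.continuousOn
  obtain ⟨C, hC⟩ := exists_nat_ge C₀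
  refine ⟨C, fun w hw h0 h1 z hz => ?_⟩
  refine norm_le_mul_sq_of_norm_deriv_deriv_le hF h0 h1 fun y hy => (hC₀ y ?_).trans hC
  rw [mem_closedBall_iff_norm] at hy
  rw [mem_closedBall_zero_iff]
  calc ‖y‖ = ‖w + (y - w)‖ := by rw [add_sub_cancel]
    _ ≤ ‖w‖ + ‖y - w‖ := norm_add_le _ _
    _ ≤ R + 1 := by linarith

/-- A random entire function whose values have uniformly bounded density has almost surely no
double zero. -/
theorem measure_exists_double_zero {Ω : Type*} [MeasurableSpace Ω] {P : Measure Ω}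
    {F : Ω → ℂ → ℂ} (hF : ∀ ω, Differentiable ℂ (F ω))
    (hP : ∀ w r, 0 ≤ r → P {ω | ‖F ω w‖ ≤ r} ≤ ENNReal.ofReal (r ^ 2)) (R : ℝ) :
    P {ω | ∃ w, ‖w‖ ≤ R ∧ F ω w = 0 ∧ deriv (F ω) w = 0} = 0 := by
  set A : ℕ → Set Ω := fun C => {ω | ∃ w, ‖w‖ ≤ R ∧
    ∀ z, ‖z - w‖ ≤ 1 → ‖F ω z‖ ≤ C * ‖z - w‖ ^ 2} with hA
  suffices h : ∀ C, P (A C) = 0 by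
    refine measure_mono_null ?_ (measure_iUnion_null h)
    rintro ω ⟨w, hw, h0, h1⟩
    obtain ⟨C, hC⟩ := exists_norm_le_mul_sq_of_double_zero (hF ω) R
    exact Set.mem_iUnion.2 ⟨C, w, hw, hC w hw h0 h1⟩
  intro C
  obtain ⟨M, hM⟩ := exists_nat_ge R
  -- Some point of the grid of mesh `1/n` lies within `2/n ≤ 1` of the double zero. At most `((2M+1)
  -- n) ^ 2` points, each of probability at most `(4C/n²) ^ 2`, give a total of order `n⁻²`.
  have key : ∀ n : ℕ, 2 ≤ n →
      P (A C) ≤ ENNReal.ofReal ((2 * M + 1) ^ 2 * 16 * C ^ 2 * ((n : ℝ)⁻¹) ^ 2) := by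
    intro n hn
    have hn0 : (0 : ℝ) < n := by positivity
    set T : Finset ℤ := Finset.Icc (-(M * n : ℤ)) (M * n) with hT
    set p : ℤ × ℤ → ℂ := fun q => ⟨q.1 / n, q.2 / n⟩ with hp
    have hsub : A C ⊆ ⋃ q ∈ T ×ˢ T, {ω | ‖F ω (p q)‖ ≤ C * (2 / n) ^ 2} := by
      rintro ω ⟨w, hw, hz⟩
      have hfl : ∀ x : ℝ, |x| ≤ ‖w‖ → ⌊n * x⌋ ∈ T ∧ |(⌊n * x⌋ : ℝ) / n - x| ≤ 1 / n := by
        intro x hx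
        have hxM := abs_le.1 (hx.trans (hw.trans hM))
        refine ⟨?_, ?_⟩
        · rw [hT, Finset.mem_Icc, Int.le_floor, ← Int.cast_le (R := ℝ)]
          push_cast
          refine ⟨by nlinarith [hxM.1], (Int.floor_le _).trans (by nlinarith [hxM.2])⟩
        · rw [show (⌊n * x⌋ : ℝ) / n - x = (⌊n * x⌋ - n * x) / n by field_simp, abs_div,
            abs_of_pos hn0]
          gcongr
          rw [abs_le]
          have h1 := Int.floor_le (n * x)
          have h2 := Int.lt_floor_add_one (n * x)
          constructor <;> linarith
      obtain ⟨h1, h2⟩ := hfl w.re (abs_re_le_norm w)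
      obtain ⟨h3, h4⟩ := hfl w.im (abs_im_le_norm w)
      have hd : ‖p (⌊n * w.re⌋, ⌊n * w.im⌋) - w‖ ≤ 2 / n := by
        refine (Complex.norm_le_abs_re_add_abs_im _).trans ?_
        rw [show (2 : ℝ) / n = 1 / n + 1 / n by ring]
        exact add_le_add h2 h4
      have h2n : (2 : ℝ) / n ≤ 1 := by
        rw [div_le_one hn0]
        exact_mod_cast hn
      refine Set.mem_biUnion (x := (⌊n * w.re⌋, ⌊n * w.im⌋)) ?_
        ((hz _ (hd.trans h2n)).trans (by gcongr))
      exact Finset.mem_product.2 ⟨h1, h3⟩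
    have hcard : ((T ×ˢ T).card : ℝ) ≤ ((2 * M + 1) * n) ^ 2 := by
      have : T.card = 2 * M * n + 1 := by
        rw [hT, Int.card_Icc]
        have : ((M * n : ℤ) + 1 - -(M * n : ℤ)) = ((2 * M * n + 1 : ℕ) : ℤ) := by push_cast; ring
        rw [this, Int.toNat_natCast]
      rw [Finset.card_product, this]
      have hn1 : (1 : ℝ) ≤ n := by exact_mod_cast (by lia : 1 ≤ n)
      push_cast
      rw [← sq]
      gcongr
      nlinarith
    calc P (A C) ≤ ∑ q ∈ T ×ˢ T, P {ω | ‖F ω (p q)‖ ≤ C * (2 / n) ^ 2} :=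
          (measure_mono hsub).trans (measure_biUnion_finset_le _ _)
      _ ≤ ∑ q ∈ T ×ˢ T, ENNReal.ofReal ((C * (2 / n) ^ 2) ^ 2) :=
          Finset.sum_le_sum fun q _ => hP _ _ (by positivity)
      _ = ENNReal.ofReal ((T ×ˢ T).card * (C * (2 / n) ^ 2) ^ 2) := by
          rw [Finset.sum_const, nsmul_eq_mul, ENNReal.ofReal_mul (by positivity),
            ENNReal.ofReal_natCast]
      _ ≤ _ := by
          refine ENNReal.ofReal_le_ofReal ((mul_le_mul_of_nonneg_right hcard
            (by positivity)).trans (le_of_eq ?_))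
          field_simp
          ring
  have hlim : Filter.Tendsto (fun n : ℕ =>
      ENNReal.ofReal ((2 * M + 1) ^ 2 * 16 * C ^ 2 * ((n : ℝ)⁻¹) ^ 2)) Filter.atTop (nhds 0) := by
    rw [← ENNReal.ofReal_zero]
    refine ENNReal.tendsto_ofReal ?_
    simpa using ((tendsto_inv_atTop_nhds_zero_nat (𝕜 := ℝ)).pow 2).const_mul
      ((2 * M + 1) ^ 2 * 16 * C ^ 2 : ℝ)
  exact le_antisymm (ge_of_tendsto hlim (Filter.eventually_atTop.2 ⟨2, key⟩)) zero_le

/-! ### Measurability of the number of zeros -/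

/-- On a compact set a nonnegative continuous function attains its minimum, so it has a zero exactly
when its infimum over a countable dense subset is 0. -/
lemma measurableSet_exists_zero_of_isCompact {Ω X : Type*} [MeasurableSpace Ω] [MetricSpace X]
    {K : Set X} (hK : IsCompact K) {f : Ω → X → ℝ} (hf : ∀ ω, Continuous (f ω))
    (h0 : ∀ ω x, 0 ≤ f ω x) (hm : ∀ x, Measurable fun ω => f ω x) :
    MeasurableSet {ω | ∃ x ∈ K, f ω x = 0} := by
  rcases K.eq_empty_or_nonempty with rfl | hne
  · simp
  have := hne.to_subtype
  have : CompactSpace K := isCompact_iff_compactSpace.1 hK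
  set d := TopologicalSpace.denseSeq K
  have heq : {ω | ∃ x ∈ K, f ω x = 0} = ⋂ j : ℕ, ⋃ i : ℕ, {ω | f ω (d i) < 1 / ((j : ℝ) + 1)} := by
    ext ω
    simp only [Set.mem_ofPred_eq, Set.mem_iInter, Set.mem_iUnion]
    constructor
    · rintro ⟨x, hx, hx0⟩ j
      have hopen : IsOpen {y : K | f ω y < 1 / ((j : ℝ) + 1)} :=
        isOpen_lt ((hf ω).comp continuous_subtype_val) continuous_const
      obtain ⟨y, hy, i, rfl⟩ := (TopologicalSpace.denseRange_denseSeq K).inter_open_nonempty _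
        hopen ⟨⟨x, hx⟩, by rw [Set.mem_ofPred_eq, hx0]; positivity⟩
      exact ⟨i, hy⟩
    · intro h
      obtain ⟨x, hx, hmin⟩ := hK.exists_isMinOn hne (hf ω).continuousOn
      refine ⟨x, hx, le_antisymm (le_of_forall_pos_lt_add fun ε hε => ?_) (h0 ω x)⟩
      obtain ⟨j, hj⟩ := exists_nat_one_div_lt hε
      obtain ⟨i, hi⟩ := h j
      rw [zero_add]
      exact (hmin (d i).2).trans_lt (hi.trans hj)
  rw [heq]
  exact MeasurableSet.iInter fun j => MeasurableSet.iUnion fun i =>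
    measurableSet_lt (hm _) measurable_const

lemma natCast_le_encard_iff {α : Type*} (n : ℕ) (S : Set α) :
    (n : ℕ∞) ≤ S.encard ↔ ∃ z : Fin n → α, Function.Injective z ∧ ∀ i, z i ∈ S := by
  constructor
  · intro h
    obtain ⟨t, htS, ht⟩ := Set.exists_subset_encard_eq h
    have htfin : t.Finite := Set.finite_of_encard_eq_coe ht
    have hcard : htfin.toFinset.card = n := by
      rw [htfin.encard_eq_coe_toFinset_card] at ht
      exact_mod_cast ht
    refine ⟨fun i => (htfin.toFinset.equivFinOfCardEq hcard).symm i,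
      Subtype.val_injective.comp (Equiv.injective _), fun i => htS ?_⟩
    exact htfin.mem_toFinset.1 (((htfin.toFinset.equivFinOfCardEq hcard).symm i).2)
  · rintro ⟨z, hz, hzS⟩
    calc (n : ℕ∞) = (Set.range z).encard := by
          rw [← Set.image_univ, hz.encard_image, Set.encard_univ]
          simp
      _ ≤ S.encard := Set.encard_le_encard (Set.range_subset_iff.2 hzS)

/-- The number of zeros of a random continuous function in an open disc is measurable. -/
lemma measurableSet_natCast_le_encard_zeros {Ω : Type*} [MeasurableSpace Ω] {f : Ω → ℂ → ℝ}
    (hf : ∀ ω, Continuous (f ω)) (h0 : ∀ ω z, 0 ≤ f ω z) (hm : ∀ z, Measurable fun ω => f ω z)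
    (R : ℝ) (n : ℕ) :
    MeasurableSet {ω | (n : ℕ∞) ≤ {z ∈ Metric.ball (0 : ℂ) R | f ω z = 0}.encard} := by
  -- Tuples of distinct points of the open disc do not form a compact set. They are exhausted by the
  -- compact sets `K m`, on which the distances to the boundary and between points are at least
  -- `1/(m+1)`.
  set K : ℕ → Set (Fin n → ℂ) := fun m => {z | (∀ i, ‖z i‖ ≤ R - 1 / ((m : ℝ) + 1)) ∧
    ∀ i j, i ≠ j → 1 / ((m : ℝ) + 1) ≤ ‖z i - z j‖} with hKdef
  have hK : ∀ m, IsCompact (K m) := by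
    intro m
    refine (isCompact_univ_pi fun _ : Fin n =>
      isCompact_closedBall (0 : ℂ) (R - 1 / ((m : ℝ) + 1))).of_isClosed_subset ?_ ?_
    · simp only [hKdef, Set.ofPred_and, Set.ofPred_forall]
      refine IsClosed.inter (isClosed_iInter fun i => isClosed_le (by fun_prop) (by fun_prop))
        (isClosed_iInter fun i => isClosed_iInter fun j => isClosed_iInter fun _ =>
          isClosed_le (by fun_prop) (by fun_prop))
    · intro z hz i _
      simpa using hz.1 i
  have heq : {ω | (n : ℕ∞) ≤ {z ∈ Metric.ball (0 : ℂ) R | f ω z = 0}.encard} =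
      ⋃ m, {ω | ∃ z ∈ K m, ∑ i, f ω (z i) = 0} := by
    ext ω
    simp only [Set.mem_ofPred_eq, Set.mem_iUnion, natCast_le_encard_iff]
    constructor
    · rintro ⟨z, hz, hzS⟩
      have hlim : ∀ x : ℝ, 0 < x → ∀ᶠ m : ℕ in Filter.atTop, 1 / ((m : ℝ) + 1) ≤ x := fun x hx =>
        (tendsto_one_div_add_atTop_nhds_zero_nat.eventually (gt_mem_nhds hx)).mono
          fun _ h => h.le
      have h1 : ∀ᶠ m : ℕ in Filter.atTop, ∀ i, 1 / ((m : ℝ) + 1) ≤ R - ‖z i‖ :=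
        Filter.eventually_all.2 fun i => hlim _ (by
          have := (hzS i).1
          rw [mem_ball_zero_iff] at this
          linarith)
      have h2 : ∀ᶠ m : ℕ in Filter.atTop, ∀ i j, i ≠ j → 1 / ((m : ℝ) + 1) ≤ ‖z i - z j‖ :=
        Filter.eventually_all.2 fun i => Filter.eventually_all.2 fun j => by
          by_cases hij : i = j
          · simp [hij]
          · exact (hlim _ (norm_pos_iff.2 (sub_ne_zero.2 (hz.ne hij)))).mono fun _ h _ => h
      obtain ⟨m, hm1, hm2⟩ := (h1.and h2).exists
      exact ⟨m, z, ⟨fun i => by linarith [hm1 i], hm2⟩,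
        Finset.sum_eq_zero fun i _ => (hzS i).2⟩
    · rintro ⟨m, z, ⟨hz1, hz2⟩, hsum⟩
      have hpos : 0 < 1 / ((m : ℝ) + 1) := by positivity
      refine ⟨z, fun i j hij => ?_, fun i => ⟨?_, ?_⟩⟩
      · by_contra hne
        have := hz2 i j hne
        rw [hij, sub_self, norm_zero] at this
        linarith
      · rw [mem_ball_zero_iff]
        linarith [hz1 i]
      · exact (Finset.sum_eq_zero_iff_of_nonneg fun i _ => h0 ω (z i)).1 hsum i
          (Finset.mem_univ i)
  rw [heq]
  refine MeasurableSet.iUnion fun m => measurableSet_exists_zero_of_isCompact (hK m)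
    (f := fun ω z => ∑ i, f ω (z i)) (fun ω => ?_) (fun ω z => Finset.sum_nonneg fun i _ => h0 _ _)
    fun z => Finset.measurable_fun_sum _ fun i _ => hm (z i)
  exact continuous_finsetSum _ fun i _ => (hf ω).comp (continuous_apply i)

lemma measurableSet_encard_zeros_eq {Ω : Type*} [MeasurableSpace Ω] {f : Ω → ℂ → ℝ}
    (hf : ∀ ω, Continuous (f ω)) (h0 : ∀ ω z, 0 ≤ f ω z) (hm : ∀ z, Measurable fun ω => f ω z)
    (R : ℝ) (n : ℕ) :
    MeasurableSet {ω | {z ∈ Metric.ball (0 : ℂ) R | f ω z = 0}.encard = n} := by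
  have heq : {ω | {z ∈ Metric.ball (0 : ℂ) R | f ω z = 0}.encard = n} =
      {ω | (n : ℕ∞) ≤ {z ∈ Metric.ball (0 : ℂ) R | f ω z = 0}.encard} \
      {ω | ((n + 1 : ℕ) : ℕ∞) ≤ {z ∈ Metric.ball (0 : ℂ) R | f ω z = 0}.encard} := by
    ext ω
    simp only [Set.mem_sdiff, Set.mem_ofPred_eq]
    rw [Nat.cast_add, Nat.cast_one, ENat.add_one_le_iff (ENat.natCast_ne_top n), not_lt,
      le_antisymm_iff, and_comm]
  rw [heq]
  exact (measurableSet_natCast_le_encard_zeros hf h0 hm R n).diff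
    (measurableSet_natCast_le_encard_zeros hf h0 hm R (n + 1))

/-! ### White noise in the Bargmann picture -/

lemma integral_sq_norm_shiftedWindow (z : ℂ) : ∫ t : ℝ, ‖shiftedWindow z t‖ ^ 2 = 1 := by
  have h1 : ∀ t : ℝ, ‖shiftedWindow z t‖ ^ 2 = (fun s : ℝ => (2 : ℝ) ^ (1 / 4 : ℝ) *
      (2 : ℝ) ^ (1 / 4 : ℝ) * Real.exp (-(2 * Real.pi) * s ^ 2)) (t - z.re) := by
    intro t
    change ‖shiftedWindowFun z t‖ ^ 2 = _
    rw [shiftedWindowFun, norm_mul, Complex.norm_real, Complex.norm_exp]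
    have : (-2 * I * Real.pi * z.im * t : ℂ).re = 0 := by simp
    rw [this, Real.exp_zero, mul_one, Real.norm_eq_abs, sq_abs, gaussianWindow, mul_pow,
      ← Real.exp_nat_mul]
    simp only [sq]
    push_cast
    ring_nf
  simp_rw [h1]
  rw [integral_sub_right_eq_self (fun s : ℝ => (2 : ℝ) ^ (1 / 4 : ℝ) *
      (2 : ℝ) ^ (1 / 4 : ℝ) * Real.exp (-(2 * Real.pi) * s ^ 2)), integral_const_mul,
    integral_gaussian]
  have h2 : Real.pi / (2 * Real.pi) = 2⁻¹ := by
    have := Real.pi_ne_zero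
    field_simp
  rw [h2, Real.sqrt_eq_rpow, Real.inv_rpow two_pos.le, ← Real.rpow_neg two_pos.le, ← neg_div]
  exact two_rpow_fourth_mul_self_mul

section

variable {Ω : Type*} [MeasurableSpace Ω] {P : Measure Ω} {ξ : Ω → 𝓢'(ℝ, ℂ)}

lemma IsComplexWhiteNoise.measurable_stft (hξ : IsComplexWhiteNoise ξ P) (z : ℂ) :
    Measurable fun ω => stft (ξ ω) z :=
  hξ.measurable _

lemma IsComplexWhiteNoise.measurableSet_zeroCount_eq (hξ : IsComplexWhiteNoise ξ P)
    (y : 𝓢'(ℝ, ℂ)) (R : ℝ) (n : ℕ) :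
    MeasurableSet {ω | zeroCount (ξ ω + y) (Metric.ball 0 R) = n} := by
  refine measurableSet_encard_zeros_eq (f := fun ω => spectrogram (ξ ω + y))
    (fun ω => continuous_spectrogram _) (fun ω z => sq_nonneg _) (fun z => ?_) R n
  have h : ∀ ω, spectrogram (ξ ω + y) z = ‖ξ ω (shiftedWindow z) + y (shiftedWindow z)‖ ^ 2 :=
    fun ω => rfl
  simp_rw [h]
  exact ((hξ.measurable _).add_const _).norm.pow_const 2

lemma IsComplexWhiteNoise.measurable_bargmann (hξ : IsComplexWhiteNoise ξ P) (w : ℂ) :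
    Measurable fun ω => bargmann (ξ ω) w :=
  (hξ.measurable _).const_mul _

variable [IsProbabilityMeasure P]

lemma IsComplexWhiteNoise.map_stft (hξ : IsComplexWhiteNoise ξ P) (z : ℂ) :
    P.map (fun ω => stft (ξ ω) z) = circularGaussian := by
  refine map_eq_circularGaussian (hξ.measurable _) fun t => ?_
  have h := hξ.characteristic (t • shiftedWindow z)
  have h1 : ∫ s : ℝ, ‖(t • shiftedWindow z) s‖ ^ 2 = ‖t‖ ^ 2 := by
    simp_rw [_root_.smul_apply, norm_smul, mul_pow]
    rw [integral_const_mul, integral_sq_norm_shiftedWindow, mul_one]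
  rw [h1] at h
  simp only [map_smul, smul_eq_mul] at h
  simp only [stft]
  rw [h]
  push_cast
  rfl

/-- The factor `e^(π‖w‖²/2)` is at least 1, so a small Bargmann transform forces the STFT of the
noise into a disc centred at `-stft y z`. The deterministic part only moves the centre, and the
bound for discs does not depend on it. -/
lemma IsComplexWhiteNoise.measure_norm_bargmann_add_le (hξ : IsComplexWhiteNoise ξ P)
    (y : 𝓢'(ℝ, ℂ)) (w : ℂ) {r : ℝ} (hr : 0 ≤ r) :
    P {ω | ‖bargmann (ξ ω + y) w‖ ≤ r} ≤ ENNReal.ofReal (r ^ 2) := by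
  set z := starRingEnd ℂ w
  have hsub : {ω | ‖bargmann (ξ ω + y) w‖ ≤ r} ⊆
      (fun ω => stft (ξ ω) z) ⁻¹' Metric.closedBall (-stft y z) r := by
    intro ω hω
    rw [Set.mem_ofPred_eq, norm_bargmann] at hω
    rw [Set.mem_preimage, mem_closedBall_iff_norm, sub_neg_eq_add]
    refine le_trans ?_ hω
    exact le_mul_of_one_le_left (norm_nonneg _) (Real.one_le_exp (by positivity))
  refine (measure_mono hsub).trans ?_
  rw [← Measure.map_apply (hξ.measurable_stft z) Metric.isClosed_closedBall.measurableSet,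
    hξ.map_stft z]
  exact circularGaussian_closedBall_le _ hr

lemma IsComplexWhiteNoise.lintegral_exp_sq_norm_stft (hξ : IsComplexWhiteNoise ξ P) (z : ℂ) :
    ∫⁻ ω, ENNReal.ofReal (Real.exp (3 / 4 * ‖stft (ξ ω) z‖ ^ 2)) ∂P = 4 := by
  rw [← lintegral_exp_circularGaussian, ← hξ.map_stft z, lintegral_map (by fun_prop)
    (hξ.measurable_stft z)]

/-- A Gaussian tail bound for the maximum of the Bargmann transform of white noise on a circle. -/
lemma IsComplexWhiteNoise.measure_exists_sphere_le_bargmann (hξ : IsComplexWhiteNoise ξ P)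
    {R r : ℝ} (hR : 0 ≤ R) (hRr : R < r)
    (hr : Real.exp (Real.pi * r ^ 2) = 3 / 2 * Real.exp (Real.pi * R ^ 2)) {v : ℝ} (hv : 0 ≤ v) :
    P {ω | ∃ w, ‖w‖ = R ∧ v ≤ ‖bargmann (ξ ω) w‖} ≤
      ENNReal.ofReal (r / (r - R) * 4 / Real.exp (Real.exp (-(Real.pi * R ^ 2)) / 2 * v ^ 2)) := by
  refine measure_exists_sphere_le (fun ω => differentiable_bargmann (ξ ω))
    hξ.measurable_bargmann (by positivity) hR hRr (fun w hw => ?_) v hv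
  refine le_of_eq ?_
  rw [show ENNReal.ofReal 4 = 4 by norm_num,
    ← hξ.lintegral_exp_sq_norm_stft (starRingEnd ℂ w)]
  refine lintegral_congr fun ω => ?_
  congr 2
  -- On the larger circle the exponent is `(1/2) e^(π(r² - R²)) ‖stft‖ ^ 2`, and `hr` turns its
  -- coefficient into `3/4`. It is below 1, as integrability against the Gaussian density requires.
  rw [norm_bargmann, hw, mul_pow, ← Real.exp_nat_mul]
  push_cast
  rw [show 2 * (Real.pi * r ^ 2 / 2) = Real.pi * r ^ 2 by ring, hr, Real.exp_neg]
  field_simp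
  ring

end

/-! ### The main theorem -/

theorem proposition3 (k : ℕ) :
    ∃ M : ℝ, 0 < M ∧
      ∀ ε : ℝ, 0 < ε → ε < 1 / 4 →
      ∀ γ : ℝ, 2 * ((k : ℝ) ^ k)⁻¹ * Real.exp k * (k.factorial : ℝ) *
          (M + √(Real.log (4 / ε))) ^ 2 < γ →
      ∀ h : Lp ℂ 2 (volume : Measure ℝ), IsHermiteFunction k h →
      ∀ (Ω : Type*) [MeasurableSpace Ω] (P : Measure Ω) [IsProbabilityMeasure P]
        (ξ : Ω → 𝓢'(ℝ, ℂ)), IsComplexWhiteNoise ξ P →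
        MeasurableSet {ω | zeroCount (ξ ω + ((√γ : ℝ) : ℂ) • (h : 𝓢'(ℝ, ℂ)))
          (Metric.ball 0 √(k / Real.pi)) = k} ∧
        ENNReal.ofReal (1 - ε) ≤
          P {ω | zeroCount (ξ ω + ((√γ : ℝ) : ℂ) • (h : 𝓢'(ℝ, ℂ)))
            (Metric.ball 0 √(k / Real.pi)) = k} := by
  have hpi := Real.pi_pos
  set R : ℝ := √(k / Real.pi) with hRdef
  have hR0 : 0 ≤ R := Real.sqrt_nonneg _
  have hR2 : R ^ 2 = k / Real.pi := Real.sq_sqrt (by positivity)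
  have hlog : 0 < Real.log (3 / 2) := Real.log_pos (by norm_num)
  set r : ℝ := √(R ^ 2 + Real.log (3 / 2) / Real.pi) with hrdef
  have hr2 : r ^ 2 = R ^ 2 + Real.log (3 / 2) / Real.pi := Real.sq_sqrt (by positivity)
  have hRr : R < r := Real.lt_sqrt_of_sq_lt (by have := div_pos hlog hpi; linarith)
  have hexpr : Real.exp (Real.pi * r ^ 2) = 3 / 2 * Real.exp (Real.pi * R ^ 2) := by
    rw [hr2, mul_add, mul_div_cancel₀ _ hpi.ne', Real.exp_add, Real.exp_log (by norm_num), mul_comm]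
  set C : ℝ := r / (r - R) * 4 with hC
  have hC0 : 0 ≤ C := by
    have := sub_pos.2 hRr
    have := hR0.trans hRr.le
    positivity
  -- `C` depends only on `R` and `r`, hence only on `k`. The shift by 1 keeps the constant positive.
  refine ⟨C + 1, by positivity, fun ε hε hε4 γ hγ h hh Ω _ P _ ξ hξ => ?_⟩
  refine ⟨hξ.measurableSet_zeroCount_eq _ R k, ?_⟩
  -- For `k = 0` the disc is empty.
  rcases Nat.eq_zero_or_pos k with rfl | hk
  · have hRz : R = 0 := by simp [hRdef]
    have huniv : {ω | zeroCount (ξ ω + ((√γ : ℝ) : ℂ) • (h : 𝓢'(ℝ, ℂ))) (Metric.ball 0 R) =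
        ((0 : ℕ) : ℕ∞)} = Set.univ := by
      simp [zeroCount, hRz]
    rw [huniv, measure_univ]
    exact ENNReal.ofReal_le_one.2 (by linarith)
  have hkpos : (0 : ℝ) < k := by exact_mod_cast hk
  have hRpos : 0 < R := Real.sqrt_pos.2 (by positivity)
  have hγ0 : 0 < γ := lt_of_le_of_lt (by positivity) hγ
  obtain ⟨a, ha, hbarg⟩ := hh.bargmann_eq
  set s : ℝ := √(Real.log (4 / ε)) with hs
  have hs2 : s ^ 2 = Real.log (4 / ε) := Real.sq_sqrt (Real.log_nonneg (by
    rw [le_div_iff₀ hε]; linarith))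
  have hs0 : 0 ≤ s := Real.sqrt_nonneg _
  set v : ℝ := √γ * ‖a‖ * R ^ k with hv
  -- With `π R ^ 2 = k`, the right side equals `γ k ^ k e^(-k) / (2 k!)`, so this is exactly the
  -- threshold on `γ`.
  have hbv : (C + 1 + s) ^ 2 ≤ Real.exp (-(Real.pi * R ^ 2)) / 2 * v ^ 2 := by
    have h1 : v ^ 2 = γ * (Real.pi ^ k / k.factorial) * (k / Real.pi) ^ k := by
      rw [hv, mul_pow, mul_pow, Real.sq_sqrt hγ0.le, ha, ← pow_mul, mul_comm k 2, pow_mul, hR2]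
    have h2 : Real.pi * R ^ 2 = k := by
      rw [hR2]; field_simp
    have hf : (0 : ℝ) < k.factorial := by exact_mod_cast k.factorial_pos
    rw [h1, h2, Real.exp_neg, div_pow]
    have h3 : (Real.exp k)⁻¹ / 2 * (γ * (Real.pi ^ k / k.factorial) * (k ^ k / Real.pi ^ k)) =
        γ / (2 * ((k : ℝ) ^ k)⁻¹ * Real.exp k * (k.factorial : ℝ)) := by
      field_simp
    rw [h3, le_div_iff₀ (by positivity), mul_comm]
    exact hγ.le
  -- Expanding `(C + 1 + s) ^ 2` and dropping the cross term separates `exp ((C + 1) ^ 2) ≥ C`,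
  -- which absorbs the prefactor of the tail bound, from `exp (s ^ 2) = 4 / ε`.
  have hexpv : C * (4 / ε) ≤ Real.exp (Real.exp (-(Real.pi * R ^ 2)) / 2 * v ^ 2) := by
    calc C * (4 / ε) ≤ Real.exp ((C + 1) ^ 2) * Real.exp (s ^ 2) := by
          rw [hs2, Real.exp_log (by positivity)]
          gcongr
          nlinarith [Real.add_one_le_exp ((C + 1) ^ 2)]
      _ ≤ _ := by
          rw [← Real.exp_add]
          refine Real.exp_le_exp.2 (le_trans ?_ hbv)
          nlinarith [mul_nonneg hC0 hs0]
  set y : 𝓢'(ℝ, ℂ) := ((√γ : ℝ) : ℂ) • (h : 𝓢'(ℝ, ℂ)) with hy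
  set B₁ : Set Ω := {ω | ∃ w, ‖w‖ ≤ R ∧ bargmann (ξ ω + y) w = 0 ∧
    deriv (bargmann (ξ ω + y)) w = 0}
  set B₂ : Set Ω := {ω | ∃ w, ‖w‖ = R ∧ v ≤ ‖bargmann (ξ ω) w‖}
  have hB₁ : P B₁ = 0 := measure_exists_double_zero (F := fun ω => bargmann (ξ ω + y))
    (fun ω => differentiable_bargmann _) (fun w r hr => hξ.measure_norm_bargmann_add_le y w hr) R
  have hB₂ : P B₂ ≤ ENNReal.ofReal ε := by
    refine (hξ.measure_exists_sphere_le_bargmann hR0 hRr hexpr (by positivity)).trans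
      (ENNReal.ofReal_le_ofReal ?_)
    rw [div_le_iff₀ (Real.exp_pos _)]
    calc C ≤ ε * (C * (4 / ε)) := by field_simp; linarith
      _ ≤ _ := by gcongr
  -- Outside `B₂` the noise is strictly dominated by the monomial on the circle, and outside `B₁`
  -- all zeros inside are simple, so the Rouché count applies.
  have hcover : (Set.univ : Set Ω) ⊆
      {ω | zeroCount (ξ ω + y) (Metric.ball 0 R) = k} ∪ B₁ ∪ B₂ := by
    intro ω _
    by_cases h2 : ω ∈ B₂
    · exact Or.inr h2
    by_cases h1 : ω ∈ B₁
    · exact Or.inl (Or.inr h1)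
    refine Or.inl (Or.inl ?_)
    rw [Set.mem_ofPred_eq, zeroCount_ball]
    refine encard_zeros_eq_of_norm_sub_lt (differentiable_bargmann _) hRpos
      (c := ((√γ : ℝ) : ℂ) * a) (fun w hw => ?_) fun w hw h0 hd => h1 ⟨w, hw.le, h0, hd⟩
    rw [bargmann_add, hy, bargmann_smul, hbarg, ← mul_assoc, add_sub_cancel_right, norm_mul,
      norm_mul, Complex.norm_real, Real.norm_of_nonneg (Real.sqrt_nonneg _), norm_pow, hw]
    exact not_le.1 fun hle => h2 ⟨w, hw, hle⟩
  rw [ENNReal.ofReal_sub _ hε.le, ENNReal.ofReal_one, tsub_le_iff_right]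
  calc (1 : ℝ≥0∞) = P Set.univ := measure_univ.symm
    _ ≤ P {ω | zeroCount (ξ ω + y) (Metric.ball 0 R) = k} + P B₁ + P B₂ :=
      (measure_mono hcover).trans ((measure_union_le _ _).trans (by
        gcongr
        exact measure_union_le _ _))
    _ ≤ _ := by
      rw [hB₁, add_zero]
      gcongr
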